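/- Let $\rho\in\mathbb{R}$, $\sigma,c\in(0,\infty)$ and let $\eta_1$ be a probability measure on $\mathbb{R}$. Consider the state-space model $Y_t=X_t+c^{-1/2}Z_t$, $X_{t+1}=\rho X_t+\sigma W_{t+1}$ for $t\ge 1$, with $X_1\sim\eta_1$ and independent $\mathcal N(0,1)$ variables $Z_t,W_{t+1}$, when all the observations are equal to zero. With $M(z,\mathrm{d}x)=\mathcal N(\rho z,\sigma^2)$, $G(x)=e^{-cx^2/2}$ and $Q(z,\mathrm{d}x)=M(z,\mathrm{d}x)G(x)$, its filtering distributions $\hat\eta_t$ and predictive distributions $\eta_t$ are given by $$\hat\eta_1(\mathrm{d}x)=\frac{G(x)\eta_1(\mathrm{d}x)}{\eta_1(G)},\qquad \hat\eta_t=\frac{\hat\eta_1Q^{t-1}}{\hat\eta_1Q^{t-1}(\mathbb{R})},\qquad \eta_t=\hat\eta_{t-1}M,\qquad t\ge 2.$$ Let $\|\pi_1-\pi_2\|=\sup_{a\in\mathbb{R}}|F_{\pi_1}(a)-F_{\pi_2}(a)|$ be the Kolmogorov distance, where $F_\pi$ is the cumulative distribution function of $\pi$ and $F_\pi^{-1}$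 its generalized inverse. For $N\ge 1$, the bootstrap particle filter with $N$ particles is driven by random points $U_t^n=(U_{t,1}^n,U_{t,2}^n)$, $t\ge 1$, $1\le n\le N$, which are independent over all $(t,n)$ and uniformly distributed on $(0,1)^2$. It sets $X_1^n=F_{\eta_1}^{-1}(U_{1,1}^n)$ and, for $t\ge 2$, $\hat X_{t-1}^n=F^{-1}_{\hat\eta_{t-1}^N}(U_{t,1}^n)$ and $X_t^n=F^{-1}_{M(\hat X_{t-1}^n,\cdot)}(U_{t,2}^n)$, where, for all $t\ge 1$, $$\eta_t^N=\frac1N\sum_{n=1}^N\delta_{X_t^n},\qquad \hat\eta_t^N=\sum_{n=1}^N W_t^n\delta_{X_t^n},\qquad W_t^n=\frac{G(X_t^n)}{\sum_{m=1}^N G(X_t^m)}.$$ Then there exists a constant $\bar C_1'\in(0,\infty)$, depending only on $\rho,\sigma,c$ and $\eta_1$, such that, for all $\kappa,q\in(0,1)$, all integers $T\ge 1$ and all integers $$N\ \ge\ \bar C_1'\,\{1+\log(1+\kappa^{-1})\}^2\,\kappa^{-2}\,\big(1+\log(T/q)\big),$$ we have $$\mathbb P\Big(\sup_{t\in\{1,\dots,T\}}\|\hat\eta_t^N-\hat\eta_t\|\le\kappa,\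 \sup_{t\in\{1,\dots,T\}}\|\eta_t^N-\eta_t\|\le\kappa\Big)\ \ge\ 1-q.$$ -/

import Mathlib

open MeasureTheory ProbabilityTheory

open scoped ENNReal

noncomputable section

namespace ParticleFilter

/-! ### Kolmogorov distance and generalized inverse of a distribution function -/

/-- The Kolmogorov distance `sup_a |F_μ(a) - F_ν(a)|`. -/
def kolmogorovDist (μ ν : Measure ℝ) : ℝ := ⨆ a : ℝ, |cdf μ a - cdf ν a|

/-- The generalized inverse `F_μ⁻¹(u) = inf {x : u ≤ F_μ(x)}`, of interest for `0 < u < 1`. -/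
def quantile (μ : Measure ℝ) (u : ℝ) : ℝ := sInf {x : ℝ | u ≤ cdf μ x}

/-! ### The model

The state-space model is `Y_t = X_t + c^{-1/2} Z_t`, `X_{t+1} = ρ X_t + σ W_{t+1}`, `X_1 ∼ η₁`, with
independent standard Gaussian `Z_t`, `W_{t+1}`; all the observations are equal to zero. -/

/-- The likelihood (up to a constant factor) of the observation `0`: `G(z) = exp (-c z² / 2)`. -/
def potential (c z : ℝ) : ℝ := Real.exp (-c * z ^ 2 / 2)

/-- The transition kernel `M(z, dx) = N(ρ z, σ²)` of the state. -/
def transition (ρ σ : ℝ) : Kernel ℝ ℝ where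
  toFun z := gaussianReal (ρ * z) (σ ^ 2).toNNReal
  measurable' := measurable_gaussianReal.comp
    ((measurable_id.const_mul ρ).prodMk measurable_const)

instance (ρ σ : ℝ) : IsMarkovKernel (transition ρ σ) :=
  ⟨fun z => inferInstanceAs (IsProbabilityMeasure (gaussianReal (ρ * z) (σ ^ 2).toNNReal))⟩

/-- The unnormalized kernel `Q(z, dx) = M(z, dx) G(x)`. -/
def fkKernel (ρ σ c : ℝ) : Kernel ℝ ℝ :=
  (transition ρ σ).withDensity fun _ x => ENNReal.ofReal (potential c x)

/-- The normalized measure `μ / μ(ℝ)`. -/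
def normalized (μ : Measure ℝ) : Measure ℝ := (μ Set.univ)⁻¹ • μ

/-- The first filtering distribution, `G(x) η₁(dx) / η₁(G)`. -/
def filterInit (c : ℝ) (η₁ : Measure ℝ) : Measure ℝ :=
  normalized (η₁.withDensity fun x => ENNReal.ofReal (potential c x))

/-- `filterDist ρ σ c η₁ k` is the filtering distribution at time `t = k + 1`: the normalization of
`(filterInit c η₁) Q^(t-1)`. -/
def filterDist (ρ σ c : ℝ) (η₁ : Measure ℝ) (k : ℕ) : Measure ℝ :=
  normalized ((filterInit c η₁).bind (fkKernel ρ σ c ^ k : Kernel ℝ ℝ))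

/-- `predictDist ρ σ c η₁ k` is the predictive distribution at time `t = k + 1`: it is `η₁` at time
`1`, and the image under `M` of the filtering distribution at time `t - 1` for `t ≥ 2`. -/
def predictDist (ρ σ c : ℝ) (η₁ : Measure ℝ) : ℕ → Measure ℝ
  | 0 => η₁
  | k + 1 => (filterDist ρ σ c η₁ k).bind (transition ρ σ)

/-! ### The algorithm -/

/-- The empirical measure `(1/N) ∑ₙ δ_{xₙ}`. -/
def empirical {N : ℕ} (x : Fin N → ℝ) : Measure ℝ :=
  ∑ n, ENNReal.ofReal (1 / N) • Measure.dirac (x n)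

/-- The normalized weights `Wₙ = G(xₙ) / ∑ₘ G(xₘ)`. -/
def weight (c : ℝ) {N : ℕ} (x : Fin N → ℝ) (n : Fin N) : ℝ :=
  potential c (x n) / ∑ m, potential c (x m)

/-- The weighted empirical measure `∑ₙ Wₙ δ_{xₙ}`. -/
def weighted (c : ℝ) {N : ℕ} (x : Fin N → ℝ) : Measure ℝ :=
  ∑ n, ENNReal.ofReal (weight c x n) • Measure.dirac (x n)

/-- The particles produced by the filtering algorithm from the points `u`; index `k` stands for
time `t = k + 1`, both for the points and for the particles. The first particles are sampled from
`η₁`. Afterwards each particle is obtained by resampling from the weighted empirical measure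
of the previous time (first coordinate), followed by a mutation according to the kernel `M`
(second coordinate). -/
def particles (ρ σ c : ℝ) (η₁ : Measure ℝ) {N : ℕ} (u : ℕ → Fin N → ℝ × ℝ) : ℕ → Fin N → ℝ
  | 0 => fun n => quantile η₁ (u 0 n).1
  | k + 1 => fun n =>
      quantile
        (transition ρ σ (quantile (weighted c (particles ρ σ c η₁ u k)) (u (k + 1) n).1))
        (u (k + 1) n).2

/-- The estimate of the predictive distribution at time `t = k + 1`. -/
def predictEst (ρ σ c : ℝ) (η₁ : Measure ℝ) {N : ℕ} (u : ℕ → Fin N → ℝ × ℝ) (k : ℕ) :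
    Measure ℝ :=
  empirical (particles ρ σ c η₁ u k)

/-- The estimate of the filtering distribution at time `t = k + 1`. -/
def filterEst (ρ σ c : ℝ) (η₁ : Measure ℝ) {N : ℕ} (u : ℕ → Fin N → ℝ × ℝ) (k : ℕ) :
    Measure ℝ :=
  weighted c (particles ρ σ c η₁ u k)

/-- The random points driving the (bootstrap) particle filter: independent random variables, over
all times and all particles, each uniformly distributed on the unit square `(0,1)²`. -/
structure IsUniformIID {Ω : Type*} [MeasurableSpace Ω] (P : Measure Ω) {N : ℕ}
    (U : ℕ → Fin N → Ω → ℝ × ℝ) : Prop where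
  measurable : ∀ k n, Measurable (U k n)
  uniform : ∀ k n, pdf.IsUniform (U k n) (Set.Ioo 0 1 ×ˢ Set.Ioo 0 1) P volume
  indep : iIndepFun (fun p : ℕ × Fin N => U p.1 p.2) P

end ParticleFilter

end

namespace ParticleFilter

open Filter Topology Set

/-! ### Distribution functions and quantiles -/

/-! Write Φ for `predictStep`. Since G and M are Gaussian, all iterates of Φ have one form: Φ^(k+1)
μ is μ tilted by some `potential b` and pushed through x ↦ N(m x, v). Here b stays in a compact
subset of (0, ∞), v stays bounded above and away from 0, and m decays geometrically for every ρ,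
even |ρ| ≥ 1 (`lintegral_iterate_predictStep`). By integration by parts, |∫ h d(μ - ν)| is at most
the Kolmogorov distance times the L¹ norm of h'. With a suitably centred h, this makes Φ^(k+1)
Lipschitz with constant K r^k, r < 1, among measures that integrate `potential B` to at least δ,
where B bounds all the b (`exists_abs_tilted_sub_le`, `exists_abs_cdf_iterate_sub_le`).

The exact predictive distributions satisfy such a lower bound uniformly in time, because m and v
stay bounded (`exists_le_integral_potential_iterate`). If each approximation is within ε of the
Φ-image of the preceding one, telescoping and a geometric series give an error O(ε) uniformly in
time; taking ε small preserves the lower bound for the approximations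
(`exists_uniform_error_bound`).

The algorithm produces such approximations: given the particles at one time, the next ones are
i.i.d. from Φ of their empirical measure, so Hoeffding bounds at O(1/ε) quantiles control the local
error (`measure_exists_lt_abs_cdf_empirical_sub_le`, `IsUniformIID.measure_step_le`). A union bound
over the T times, with ε proportional to κ, concludes: the grid costs a logarithm of 1/κ and the T
times cost log (T/q). -/

lemma quantile_le_iff (μ : Measure ℝ) {u : ℝ} (hu : u ∈ Ioo (0 : ℝ) 1) (a : ℝ) :
    quantile μ u ≤ a ↔ u ≤ cdf μ a := by
  have hne : {x : ℝ | u ≤ cdf μ x}.Nonempty :=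
    ((tendsto_cdf_atTop μ).eventually_const_le hu.2).exists
  have hbdd : BddBelow {x : ℝ | u ≤ cdf μ x} := by
    obtain ⟨b, hb⟩ := ((tendsto_cdf_atBot μ).eventually_lt_const hu.1).exists
    refine ⟨b, fun x hx => ?_⟩
    by_contra! h
    exact absurd (hx.trans (monotone_cdf μ h.le)) (not_le.mpr hb)
  constructor
  · intro h
    have hcont : Tendsto (cdf μ) (𝓝[>] a) (𝓝 (cdf μ a)) :=
      ((cdf μ).right_continuous a).tendsto.mono_left (nhdsWithin_mono _ Ioi_subset_Ici_self)
    refine ge_of_tendsto hcont ?_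
    filter_upwards [self_mem_nhdsWithin] with x hx
    obtain ⟨y, hy, hyx⟩ := exists_lt_of_csInf_lt hne (lt_of_le_of_lt h hx)
    exact le_trans hy (monotone_cdf μ hyx.le)
  · exact fun h => csInf_le hbdd h

lemma le_cdf_quantile (μ : Measure ℝ) {u : ℝ} (hu : u ∈ Ioo (0 : ℝ) 1) :
    u ≤ cdf μ (quantile μ u) := (quantile_le_iff μ hu _).1 le_rfl

lemma measurable_cdf_apply {α : Type*} [MeasurableSpace α] {Z : α → Measure ℝ}
    (hp : ∀ z, IsProbabilityMeasure (Z z)) (hZ : Measurable Z) (a : ℝ) :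
    Measurable fun z => cdf (Z z) a := by
  simp_rw [cdf_eq_real, measureReal_def]
  exact ((Measure.measurable_coe measurableSet_Iic).comp hZ).ennreal_toReal

lemma measurable_quantile {α : Type*} [MeasurableSpace α] {Z : α → Measure ℝ} {v : α → ℝ}
    (hZ : ∀ a, Measurable fun z => cdf (Z z) a) (hv : Measurable v)
    (hv' : ∀ z, v z ∈ Ioo (0 : ℝ) 1) : Measurable fun z => quantile (Z z) (v z) := by
  refine measurable_of_Iic fun a => ?_
  have : (fun z => quantile (Z z) (v z)) ⁻¹' Iic a = {z | v z ≤ cdf (Z z) a} := by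
    ext z
    exact quantile_le_iff _ (hv' z) a
  rw [this]
  exact measurableSet_le hv (hZ a)

lemma map_quantile_uniform (μ : Measure ℝ) [IsProbabilityMeasure μ] :
    (volume.restrict (Ioo (0 : ℝ) 1)).map (quantile μ) = μ := by
  have hae : AEMeasurable (quantile μ) (volume.restrict (Ioo (0 : ℝ) 1)) := by
    -- The equivalence with the cdf holds only on (0, 1), so u is replaced by 1/2 elsewhere; this
    -- changes nothing almost everywhere.
    have hm : Measurable fun u : ℝ => quantile μ (if u ∈ Ioo (0 : ℝ) 1 then u else 1 / 2) := by
      refine measurable_quantile (fun _ => measurable_const)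
        (Measurable.ite measurableSet_Ioo measurable_id measurable_const) fun u => ?_
      split_ifs with h
      · exact h
      · norm_num
    refine ⟨_, hm, ?_⟩
    filter_upwards [ae_restrict_mem measurableSet_Ioo] with u hu
    simp [hu.1, hu.2]
  have : IsProbabilityMeasure (volume.restrict (Ioo (0 : ℝ) 1)) := ⟨by simp⟩
  have := Measure.isProbabilityMeasure_map hae
  refine Measure.eq_of_cdf _ _ (StieltjesFunction.ext fun a => ?_)
  rw [cdf_eq_real, map_measureReal_apply_of_aemeasurable hae measurableSet_Iic, measureReal_def,
    Measure.restrict_apply' measurableSet_Ioo]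
  have : (quantile μ ⁻¹' Iic a ∩ Ioo 0 1 : Set ℝ) =ᵐ[volume] (Ioc (0 : ℝ) (cdf μ a) : Set ℝ) := by
    have h1 : ∀ᵐ u : ℝ, u ≠ 1 := by simp [ae_iff]
    filter_upwards [h1] with u hu
    refine propext ?_
    change (quantile μ u ≤ a ∧ u ∈ Ioo (0 : ℝ) 1) ↔ u ∈ Ioc (0 : ℝ) (cdf μ a)
    constructor
    · rintro ⟨h, h'⟩
      exact ⟨h'.1, (quantile_le_iff μ h' a).1 h⟩
    · intro h
      have h' : u ∈ Ioo (0 : ℝ) 1 := ⟨h.1, lt_of_le_of_ne (h.2.trans (cdf_le_one μ a)) hu⟩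
      exact ⟨(quantile_le_iff μ h' a).2 h.2, h'⟩
  rw [measure_congr this]
  simp [cdf_nonneg]

/-! ### Integrals against measures that are close in Kolmogorov distance -/

/-- Fubini on the half-plane x ≤ y: for fixed y the section in x is `Iic y`, whose μ-mass is the cdf
at y. -/
lemma integral_integral_Ici (μ : Measure ℝ) [IsProbabilityMeasure μ] {g : ℝ → ℝ}
    (hg : Integrable g) :
    Integrable (fun x => ∫ y in Ici x, g y) μ ∧
      ∫ x, (∫ y in Ici x, g y) ∂μ = ∫ y, g y * cdf μ y := by
  have hS : MeasurableSet {p : ℝ × ℝ | p.1 ≤ p.2} := measurableSet_le measurable_fst measurable_snd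
  have hint : Integrable (fun p : ℝ × ℝ => {p : ℝ × ℝ | p.1 ≤ p.2}.indicator
      (fun p => g p.2) p) (μ.prod volume) := (hg.comp_snd μ).indicator hS
  have h1 : ∀ x : ℝ, ∫ y in Ici x, g y =
      ∫ y, {p : ℝ × ℝ | p.1 ≤ p.2}.indicator (fun p => g p.2) (x, y) := by
    intro x
    rw [← integral_indicator measurableSet_Ici]
    rfl
  simp_rw [h1]
  refine ⟨hint.integral_prod_left, ?_⟩
  rw [integral_integral_swap hint]
  refine integral_congr_ae (Eventually.of_forall fun y => ?_)
  have h2 : (fun x : ℝ => {p : ℝ × ℝ | p.1 ≤ p.2}.indicator (fun p => g p.2) (x, y)) =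
      (Iic y).indicator fun _ => g y := by
    ext x
    rfl
  simp only [h2]
  rw [integral_indicator_const _ measurableSet_Iic, cdf_eq_real, smul_eq_mul, mul_comm]

/-- Integration by parts. A function given as a tail integral vanishes at +∞, so there is no
boundary term. -/
lemma abs_integral_sub_integral_le {μ ν : Measure ℝ} [IsProbabilityMeasure μ]
    [IsProbabilityMeasure ν] {D : ℝ} (hD : ∀ a, |cdf μ a - cdf ν a| ≤ D) {g h : ℝ → ℝ}
    (hg : Integrable g) (hh : ∀ x, h x = ∫ y in Ici x, g y) :
    |∫ x, h x ∂μ - ∫ x, h x ∂ν| ≤ D * ∫ y, |g y| := by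
  have hm : ∀ (π : Measure ℝ), Integrable fun y => g y * cdf π y := fun π =>
    hg.mul_bdd (c := 1) (monotone_cdf π).measurable.aestronglyMeasurable
      (Eventually.of_forall fun y => by
        rw [Real.norm_of_nonneg (cdf_nonneg π y)]; exact cdf_le_one π y)
  simp_rw [hh]
  rw [(integral_integral_Ici μ hg).2, (integral_integral_Ici ν hg).2,
    ← integral_sub (hm μ) (hm ν), ← integral_const_mul]
  refine (abs_integral_le_integral_abs).trans
    (integral_mono ((hm μ).sub (hm ν)).abs (hg.abs.const_mul D) fun y => ?_)
  simp only [← mul_sub, abs_mul]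
  rw [mul_comm]
  exact mul_le_mul_of_nonneg_right (hD y) (abs_nonneg _)

/-! ### Gaussian computations -/

lemma potential_pos (b x : ℝ) : 0 < potential b x := Real.exp_pos _

lemma potential_zero (x : ℝ) : potential 0 x = 1 := by simp [potential]

lemma potential_anti {b b' : ℝ} (h : b ≤ b') (x : ℝ) : potential b' x ≤ potential b x := by
  refine Real.exp_le_exp.2 ?_
  nlinarith [mul_le_mul_of_nonneg_right h (sq_nonneg x)]

lemma potential_le_one {b : ℝ} (hb : 0 ≤ b) (x : ℝ) : potential b x ≤ 1 :=
  (potential_anti hb x).trans_eq (potential_zero x)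

lemma potential_mul (b b' x : ℝ) : potential b x * potential b' x = potential (b + b') x := by
  rw [potential, potential, potential, ← Real.exp_add]
  congr 1
  ring

@[fun_prop]
lemma continuous_potential (b : ℝ) : Continuous (potential b) := by
  unfold potential
  fun_prop

@[fun_prop]
lemma measurable_potential (b : ℝ) : Measurable (potential b) := (continuous_potential b).measurable

/-- Complete the square: a Gaussian density times `potential b` is a multiple of another Gaussian
density. This is the Kalman update. -/
lemma lintegral_potential_gaussianReal {b : ℝ} (hb : 0 ≤ b) (p : ℝ) {v : NNReal} (hv : v ≠ 0)
    {f : ℝ → ℝ≥0∞} (hf : Measurable f) :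
    ∫⁻ y, ENNReal.ofReal (potential b y) * f y ∂gaussianReal p v =
      ENNReal.ofReal ((√(1 + b * v))⁻¹ * potential (b / (1 + b * v)) p) *
        ∫⁻ y, f y ∂gaussianReal (p / (1 + b * v)) (v / (1 + b * v)).toNNReal := by
  have hv0 : (0 : ℝ) < v := by positivity
  have hγ : 0 < 1 + b * v := by positivity
  have hv' : ((v : ℝ) / (1 + b * v)).toNNReal ≠ 0 := by
    rw [Ne, Real.toNNReal_eq_zero, not_le]
    positivity
  rw [gaussianReal_of_var_ne_zero _ hv, gaussianReal_of_var_ne_zero _ hv',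
    lintegral_withDensity_eq_lintegral_mul _ (measurable_gaussianPDF _ _) (by fun_prop),
    lintegral_withDensity_eq_lintegral_mul _ (measurable_gaussianPDF _ _) hf,
    ← lintegral_const_mul _ ((measurable_gaussianPDF _ _).mul hf)]
  refine lintegral_congr fun y => ?_
  simp only [Pi.mul_apply, ← mul_assoc, gaussianPDF]
  rw [← ENNReal.ofReal_mul (gaussianPDFReal_nonneg _ _ _), ← ENNReal.ofReal_mul (by
    have := (potential_pos (b / (1 + b * v)) p).le
    positivity)]
  congr 2
  have h1 : √(2 * Real.pi * v) = √(1 + b * v) * √(2 * Real.pi * (v / (1 + b * v))) := by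
    rw [← Real.sqrt_mul hγ.le]
    congr 1
    field_simp
  simp only [gaussianPDFReal, potential]
  rw [Real.coe_toNNReal _ (by positivity), h1, mul_inv]
  have h2 : Real.exp (-(y - p) ^ 2 / (2 * v)) * Real.exp (-b * y ^ 2 / 2) =
      Real.exp (-(b / (1 + b * v)) * p ^ 2 / 2) *
        Real.exp (-(y - p / (1 + b * v)) ^ 2 / (2 * (v / (1 + b * v)))) := by
    rw [← Real.exp_add, ← Real.exp_add]
    congr 1
    field_simp
    ring
  linear_combination (√(1 + b * v))⁻¹ * (√(2 * Real.pi * (v / (1 + b * v))))⁻¹ * h2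

/-- The Kalman prediction: m Y plus independent centred Gaussian noise is Gaussian. -/
lemma lintegral_gaussianReal_gaussianReal (m p : ℝ) (u v : NNReal) {f : ℝ → ℝ≥0∞}
    (hf : Measurable f) :
    ∫⁻ y, ∫⁻ z, f z ∂gaussianReal (m * y) v ∂gaussianReal p u =
      ∫⁻ z, f z ∂gaussianReal (m * p) (v + (m ^ 2 * u).toNNReal) := by
  have h1 : gaussianReal (m * p) (v + (m ^ 2 * u).toNNReal) =
      (gaussianReal p u).map (m * ·) ∗ gaussianReal 0 v := by
    rw [gaussianReal_map_const_mul, gaussianReal_conv_gaussianReal, add_zero, add_comm]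
    congr 2
    ext
    rw [Real.coe_toNNReal _ (by positivity)]
    rfl
  rw [h1, Measure.lintegral_conv hf, lintegral_map (by fun_prop) (by fun_prop)]
  refine lintegral_congr fun y => ?_
  rw [← lintegral_map (f := f) (g := fun z => m * y + z) hf (by fun_prop),
    gaussianReal_map_const_add, zero_add]

lemma measurable_lintegral_gaussianReal (m : ℝ) (v : NNReal) {f : ℝ → ℝ≥0∞} (hf : Measurable f) :
    Measurable fun x => ∫⁻ z, f z ∂gaussianReal (m * x) v :=
  (Measure.measurable_lintegral hf).comp 
    (measurable_gaussianReal.comp ((measurable_id.const_mul m).prodMk measurable_const))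

/-! ### One step of the filter -/

/-- The Bayes update of `μ` by the likelihood `potential c`. -/
noncomputable def bayesUpdate (c : ℝ) (μ : Measure ℝ) : Measure ℝ :=
  normalized (μ.withDensity fun x => ENNReal.ofReal (potential c x))

/-- The map sending a predictive distribution to the next one. -/
noncomputable def predictStep (ρ σ c : ℝ) (μ : Measure ℝ) : Measure ℝ :=
  (bayesUpdate c μ).bind (transition ρ σ)

lemma lintegral_potential_ne_zero (b : ℝ) {μ : Measure ℝ} (hμ : μ ≠ 0) :
    ∫⁻ x, ENNReal.ofReal (potential b x) ∂μ ≠ 0 := by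
  rw [Ne, lintegral_eq_zero_iff (by fun_prop)]
  intro h
  refine hμ (ae_eq_bot.1 (Filter.eventually_false_iff_eq_bot.1 ?_))
  filter_upwards [h] with x hx
  simp only [Pi.zero_apply, ENNReal.ofReal_eq_zero] at hx
  exact absurd (potential_pos b x) (not_lt.2 hx)

lemma lintegral_potential_le {b : ℝ} (hb : 0 ≤ b) (μ : Measure ℝ) :
    ∫⁻ x, ENNReal.ofReal (potential b x) ∂μ ≤ μ univ := by
  rw [← lintegral_one]
  exact lintegral_mono fun x => ENNReal.ofReal_le_one.2 (potential_le_one hb x)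

lemma isProbabilityMeasure_normalized {μ : Measure ℝ} (h0 : μ univ ≠ 0) (h1 : μ univ ≠ ∞) :
    IsProbabilityMeasure (normalized μ) :=
  ⟨by simp [normalized, ENNReal.inv_mul_cancel h0 h1]⟩

lemma normalized_smul {a : ℝ≥0∞} (h0 : a ≠ 0) (h1 : a ≠ ∞) (μ : Measure ℝ) :
    normalized (a • μ) = normalized μ := by
  simp only [normalized, Measure.smul_apply, smul_eq_mul]
  rw [ENNReal.mul_inv (Or.inl h0) (Or.inl h1), smul_smul, mul_comm a⁻¹, mul_assoc,
    ENNReal.inv_mul_cancel h0 h1, mul_one]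

lemma normalized_eq_self (μ : Measure ℝ) [IsProbabilityMeasure μ] : normalized μ = μ := by
  simp [normalized]

lemma isProbabilityMeasure_bayesUpdate {c : ℝ} (hc : 0 ≤ c) (μ : Measure ℝ)
    [IsProbabilityMeasure μ] : IsProbabilityMeasure (bayesUpdate c μ) := by
  refine isProbabilityMeasure_normalized ?_ ?_ <;> rw [withDensity_apply _ .univ, setLIntegral_univ]
  · exact lintegral_potential_ne_zero c (IsProbabilityMeasure.ne_zero μ)
  · exact ((lintegral_potential_le hc μ).trans_lt (measure_lt_top μ univ)).ne

lemma isProbabilityMeasure_predictStep (ρ σ : ℝ) {c : ℝ} (hc : 0 ≤ c) (μ : Measure ℝ)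
    [IsProbabilityMeasure μ] : IsProbabilityMeasure (predictStep ρ σ c μ) := by
  have := isProbabilityMeasure_bayesUpdate hc μ
  exact inferInstanceAs (IsProbabilityMeasure (transition ρ σ ∘ₘ bayesUpdate c μ))

lemma lintegral_bayesUpdate {c : ℝ} (hc : 0 ≤ c) (μ : Measure ℝ) [IsProbabilityMeasure μ]
    {f : ℝ → ℝ≥0∞} (hf : Measurable f) :
    (∫⁻ x, ENNReal.ofReal (potential c x) ∂μ) * ∫⁻ x, f x ∂bayesUpdate c μ =
      ∫⁻ x, ENNReal.ofReal (potential c x) * f x ∂μ := by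
  rw [bayesUpdate, normalized, lintegral_smul_measure,
    lintegral_withDensity_eq_lintegral_mul _ (by fun_prop) hf, withDensity_apply _ .univ,
    setLIntegral_univ, smul_eq_mul, ← mul_assoc, ENNReal.mul_inv_cancel, one_mul]
  · rfl
  · exact lintegral_potential_ne_zero c (IsProbabilityMeasure.ne_zero μ)
  · exact ((lintegral_potential_le hc μ).trans_lt (measure_lt_top μ univ)).ne

lemma lintegral_predictStep (ρ σ : ℝ) {c : ℝ} (hc : 0 ≤ c) (μ : Measure ℝ)
    [IsProbabilityMeasure μ] {f : ℝ → ℝ≥0∞} (hf : Measurable f) :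
    (∫⁻ x, ENNReal.ofReal (potential c x) ∂μ) * ∫⁻ x, f x ∂predictStep ρ σ c μ =
      ∫⁻ x, ENNReal.ofReal (potential c x) *
        ∫⁻ y, f y ∂gaussianReal (ρ * x) (σ ^ 2).toNNReal ∂μ := by
  rw [predictStep, Measure.lintegral_bind (transition ρ σ).aemeasurable hf.aemeasurable,
    ← lintegral_bayesUpdate hc μ (measurable_lintegral_gaussianReal _ _ hf)]
  rfl

/-- Scalars pass through `bind` and `withDensity`, so normalizing once at the end or at each step
gives the same result, provided that no intermediate mass is 0 or ∞. -/
lemma filterDist_eq_bayesUpdate (ρ σ : ℝ) {c : ℝ} (hc : 0 ≤ c) (η : Measure ℝ)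
    [IsProbabilityMeasure η] (k : ℕ) :
    filterDist ρ σ c η k = bayesUpdate c (predictDist ρ σ c η k) := by
  have hpot : Measurable fun x => ENNReal.ofReal (potential c x) := by fun_prop
  set R : ℕ → Measure ℝ := fun k => (filterInit c η).bind (fkKernel ρ σ c ^ k : Kernel ℝ ℝ) with hR
  have hR0 : R 0 = filterInit c η := Measure.bind_dirac
  have hsucc : ∀ k, R (k + 1) = ((R k).bind (transition ρ σ)).withDensity
      fun x => ENNReal.ofReal (potential c x) := by
    intro k
    have h1 : R (k + 1) = (R k).bind (fkKernel ρ σ c) := by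
      simp only [hR, pow_succ']
      exact (Measure.bind_bind (Kernel.aemeasurable _) (Kernel.aemeasurable _)).symm
    rw [h1]
    ext s hs
    rw [Measure.bind_apply hs (Kernel.aemeasurable _), withDensity_apply _ hs,
      ← lintegral_indicator hs,
      Measure.lintegral_bind (Kernel.aemeasurable _) (hpot.indicator hs).aemeasurable]
    refine lintegral_congr fun x => ?_
    rw [fkKernel, Kernel.withDensity_apply' _ (by fun_prop), lintegral_indicator hs]
  have hmass : ∀ k, R k univ ≠ 0 ∧ R k univ ≠ ∞ := by
    intro k
    induction k with
    | zero =>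
      have := isProbabilityMeasure_bayesUpdate hc η
      rw [hR0]
      change bayesUpdate c η univ ≠ 0 ∧ bayesUpdate c η univ ≠ ∞
      simp
    | succ k ih =>
      have hb : ((R k).bind (transition ρ σ)) univ = R k univ := by
        rw [Measure.bind_apply .univ (Kernel.aemeasurable _)]
        simp
      rw [hsucc, withDensity_apply _ .univ, setLIntegral_univ]
      constructor
      · refine lintegral_potential_ne_zero c fun h => ih.1 ?_
        rw [← hb, h]
        rfl
      · exact ((lintegral_potential_le hc _).trans_lt (hb ▸ ih.2.lt_top)).ne
  cases k with
  | zero =>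
    have := isProbabilityMeasure_bayesUpdate hc η
    change normalized (R 0) = bayesUpdate c η
    rw [hR0]
    exact normalized_eq_self (bayesUpdate c η)
  | succ k =>
    change normalized (R (k + 1)) = normalized (((normalized (R k)).bind (transition ρ σ)).withDensity
      fun x => ENNReal.ofReal (potential c x))
    rw [hsucc, normalized, normalized, normalized, Measure.bind_smul, withDensity_smul_measure]
    exact (normalized_smul (ENNReal.inv_ne_zero.2 (hmass k).2) (ENNReal.inv_ne_top.2 (hmass k).1)
      _).symm

lemma predictDist_eq_iterate (ρ σ : ℝ) {c : ℝ} (hc : 0 ≤ c) (η : Measure ℝ)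
    [IsProbabilityMeasure η] (k : ℕ) :
    predictDist ρ σ c η k = (predictStep ρ σ c)^[k] η := by
  induction k with
  | zero => rfl
  | succ k ih =>
    rw [Function.iterate_succ_apply', ← ih, predictDist, filterDist_eq_bayesUpdate ρ σ hc]
    rfl

lemma isProbabilityMeasure_iterate (ρ σ : ℝ) {c : ℝ} (hc : 0 ≤ c) (η : Measure ℝ)
    [IsProbabilityMeasure η] (k : ℕ) : IsProbabilityMeasure ((predictStep ρ σ c)^[k] η) := by
  induction k with
  | zero => assumption
  | succ k ih =>
    rw [Function.iterate_succ_apply']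
    exact isProbabilityMeasure_predictStep ρ σ hc _

/-! ### The iterated filter in closed form -/

/-- Prepending one step of Φ keeps the form, with γ = 1 + b σ² and the Riccati-type recursion b ↦ c
+ b ρ²/γ, m ↦ m ρ/γ, v ↦ v + m² σ²/γ. Along it m²/b shrinks by at least the factor 1 + c σ², while v
+ m²/b does not increase; these two facts replace any condition on ρ. The identity is kept
multiplicative to avoid dividing by the normalizing mass. -/
lemma lintegral_iterate_predictStep (ρ : ℝ) {σ c : ℝ} (hσ : 0 < σ) (hc : 0 < c) (k : ℕ) :
    ∃ (b m : ℝ) (v : NNReal), c ≤ b ∧ b ≤ c + ρ ^ 2 / σ ^ 2 ∧ σ ^ 2 ≤ v ∧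
      v + m ^ 2 / b ≤ σ ^ 2 + ρ ^ 2 / c ∧ m ^ 2 / b ≤ ρ ^ 2 / c * ((1 + c * σ ^ 2)⁻¹) ^ k ∧
      ∀ (μ : Measure ℝ) [IsProbabilityMeasure μ] (f : ℝ → ℝ≥0∞), Measurable f →
        (∫⁻ x, ENNReal.ofReal (potential b x) ∂μ) * ∫⁻ x, f x ∂(predictStep ρ σ c)^[k + 1] μ =
          ∫⁻ x, ENNReal.ofReal (potential b x) * ∫⁻ y, f y ∂gaussianReal (m * x) v ∂μ := by
  have hσ2 : ((σ ^ 2).toNNReal : ℝ) = σ ^ 2 := Real.coe_toNNReal _ (sq_nonneg σ)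
  induction k with
  | zero =>
    refine ⟨c, ρ, (σ ^ 2).toNNReal, le_rfl, by simp; positivity, hσ2.ge, by rw [hσ2], by simp,
      fun μ _ f hf => ?_⟩
    exact lintegral_predictStep ρ σ hc.le μ hf
  | succ k ih =>
    obtain ⟨b, m, v, hcb, hbB, hv, hs, hn, h⟩ := ih
    have hb : 0 < b := hc.trans_le hcb
    have hγ : 0 < 1 + b * σ ^ 2 := by positivity
    set γ := 1 + b * σ ^ 2 with hγdef
    have hb' : 0 < c + b * ρ ^ 2 / γ := by positivity
    have hn0 : 0 ≤ m ^ 2 / b := by positivity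
    have hcγ : 1 + c * σ ^ 2 ≤ γ := by
      have := mul_le_mul_of_nonneg_right hcb (sq_nonneg σ)
      linarith
    have hratio : (m * ρ / γ) ^ 2 / (c + b * ρ ^ 2 / γ) ≤ m ^ 2 / b * γ⁻¹ := by
      rw [div_le_iff₀ hb']
      have : (m * ρ / γ) ^ 2 = m ^ 2 / b * γ⁻¹ * (b * ρ ^ 2 / γ) := by
        field_simp
      rw [this]
      exact mul_le_mul_of_nonneg_left (by linarith) (by positivity)
    have hvm : ((v + (m ^ 2 * (σ ^ 2 / γ).toNNReal).toNNReal : NNReal) : ℝ) =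
        v + m ^ 2 * (σ ^ 2 / γ) := by
      rw [NNReal.coe_add, Real.coe_toNNReal _ (by positivity), Real.coe_toNNReal _ (by positivity)]
    refine ⟨c + b * ρ ^ 2 / γ, m * ρ / γ, v + (m ^ 2 * (σ ^ 2 / γ).toNNReal).toNNReal,
      by simp; positivity, ?_, ?_, ?_, ?_, fun μ _ f hf => ?_⟩
    -- From γ ≥ b σ², b ρ²/γ ≤ ρ²/σ².
    · refine add_le_add_right ?_ c
      rw [div_le_div_iff₀ hγ (by positivity)]
      nlinarith [sq_nonneg ρ]
    · rw [hvm]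
      have : 0 ≤ m ^ 2 * (σ ^ 2 / γ) := by positivity
      linarith
    · rw [hvm]
      -- What v gains is exactly what the bound on m²/b loses.
      have : m ^ 2 * (σ ^ 2 / γ) + m ^ 2 / b * γ⁻¹ = m ^ 2 / b := by
        rw [hγdef] at *
        field_simp
        ring
      linarith
    · refine hratio.trans ?_
      rw [pow_succ ((1 + c * σ ^ 2)⁻¹), ← mul_assoc]
      exact mul_le_mul hn (by gcongr) (by positivity) (by positivity)
    · set α : ℝ := (√γ)⁻¹ with hα
      have hα0 : 0 < α := by positivity
      have hσ' : (σ ^ 2).toNNReal ≠ 0 := by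
        rw [Ne, Real.toNNReal_eq_zero, not_le]
        positivity
      have hstep : ∀ (f : ℝ → ℝ≥0∞), Measurable f →
          (∫⁻ x, ENNReal.ofReal (potential c x) ∂μ) *
            ∫⁻ x, ENNReal.ofReal (potential b x) * ∫⁻ y, f y ∂gaussianReal (m * x) v
              ∂predictStep ρ σ c μ =
          ENNReal.ofReal α * ∫⁻ x, ENNReal.ofReal (potential (c + b * ρ ^ 2 / γ) x) *
            ∫⁻ y, f y ∂gaussianReal (m * ρ / γ * x)
              (v + (m ^ 2 * (σ ^ 2 / γ).toNNReal).toNNReal) ∂μ := by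
        intro f hf
        have hmf := measurable_lintegral_gaussianReal m v hf
        have hmf' := measurable_lintegral_gaussianReal (m * ρ / γ)
          (v + (m ^ 2 * (σ ^ 2 / γ).toNNReal).toNNReal) hf
        rw [lintegral_predictStep ρ σ hc.le μ (by fun_prop), ← lintegral_const_mul _ (by fun_prop)]
        refine lintegral_congr fun x => ?_
        rw [lintegral_potential_gaussianReal hb.le _ hσ' hmf, hσ2, ← hγdef,
          lintegral_gaussianReal_gaussianReal _ _ _ _ hf, ← mul_assoc, ← mul_assoc,
          ← ENNReal.ofReal_mul (potential_pos _ _).le, ← ENNReal.ofReal_mul hα0.le]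
        congr 2
        · rw [← potential_mul]
          have : potential (b / γ) (ρ * x) = potential (b * ρ ^ 2 / γ) x := by
            unfold potential
            congr 1
            field_simp
          rw [this]
          ring
        · congr 1
          field_simp
      have hA := hstep f hf
      -- Taking f = 1 computes the normalizing mass with the same factor α, which then cancels.
      have hB := hstep 1 measurable_one
      simp only [Pi.one_apply, lintegral_one, measure_univ, mul_one] at hB
      have := isProbabilityMeasure_predictStep ρ σ hc.le μ
      have hF := h (predictStep ρ σ c μ) f hf
      rw [← Function.iterate_succ_apply (predictStep ρ σ c)] at hF
      rw [← hF, ← mul_assoc, hB, mul_assoc] at hA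
      exact (ENNReal.mul_right_inj (ENNReal.ofReal_pos.2 hα0).ne' ENNReal.ofReal_ne_top).1 hA

lemma integrable_potential {b : ℝ} (hb : 0 ≤ b) (μ : Measure ℝ) [IsFiniteMeasure μ] :
    Integrable (potential b) μ :=
  Integrable.of_bound (continuous_potential b).aestronglyMeasurable 1
    (Eventually.of_forall fun x => by
      rw [Real.norm_of_nonneg (potential_pos b x).le]; exact potential_le_one hb x)

lemma integral_eq_of_lintegral_eq {μ π : Measure ℝ} [IsProbabilityMeasure μ]
    [IsProbabilityMeasure π] {b : ℝ} {h : ℝ → ℝ} (hh0 : ∀ x, 0 ≤ h x)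
    (hm : Measurable h) {f : ℝ → ℝ} (hf0 : ∀ x, 0 ≤ f x) (hf : Measurable f)
    (H : (∫⁻ x, ENNReal.ofReal (potential b x) ∂μ) * ∫⁻ x, ENNReal.ofReal (f x) ∂π =
      ∫⁻ x, ENNReal.ofReal (potential b x) * ENNReal.ofReal (h x) ∂μ) :
    (∫ x, f x ∂π) * ∫ x, potential b x ∂μ = ∫ x, potential b x * h x ∂μ := by
  rw [integral_eq_lintegral_of_nonneg_ae (Eventually.of_forall hf0) hf.aestronglyMeasurable,
    integral_eq_lintegral_of_nonneg_ae (Eventually.of_forall fun x => (potential_pos b x).le)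
      (by fun_prop),
    integral_eq_lintegral_of_nonneg_ae
      (Eventually.of_forall fun x => mul_nonneg (potential_pos b x).le (hh0 x)) (by fun_prop),
    ← ENNReal.toReal_mul, mul_comm, H]
  simp_rw [ENNReal.ofReal_mul (potential_pos b _).le]

lemma cdf_eq_integral (π : Measure ℝ) [IsProbabilityMeasure π] (a : ℝ) :
    cdf π a = ∫ x, (Iic a).indicator (fun _ => (1 : ℝ)) x ∂π := by
  rw [integral_indicator_const _ measurableSet_Iic, cdf_eq_real, smul_eq_mul, mul_one]

lemma lintegral_indicator_Iic (π : Measure ℝ) [IsProbabilityMeasure π] (a : ℝ) :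
    ∫⁻ x, ENNReal.ofReal ((Iic a).indicator (fun _ => (1 : ℝ)) x) ∂π =
      ENNReal.ofReal (cdf π a) := by
  rw [ofReal_cdf, ← lintegral_indicator_one measurableSet_Iic]
  refine lintegral_congr fun x => ?_
  by_cases hx : x ∈ Iic a <;> simp [hx]

lemma cdf_bayesUpdate {c : ℝ} (hc : 0 ≤ c) (μ : Measure ℝ) [IsProbabilityMeasure μ] (a : ℝ) :
    cdf (bayesUpdate c μ) a * ∫ x, potential c x ∂μ =
      ∫ x, potential c x * (Iic a).indicator (fun _ => (1 : ℝ)) x ∂μ := by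
  have := isProbabilityMeasure_bayesUpdate hc μ
  have hI : Measurable ((Iic a).indicator fun _ : ℝ => (1 : ℝ)) :=
    measurable_const.indicator measurableSet_Iic
  have h0 : ∀ x, 0 ≤ (Iic a).indicator (fun _ : ℝ => (1 : ℝ)) x :=
    fun x => indicator_nonneg (fun _ _ => zero_le_one) x
  rw [cdf_eq_integral]
  exact integral_eq_of_lintegral_eq h0 hI h0 hI (lintegral_bayesUpdate hc μ (by fun_prop))

lemma measurable_cdf_gaussianReal (m : ℝ) (v : NNReal) (a : ℝ) :
    Measurable fun x => cdf (gaussianReal (m * x) v) a :=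
  measurable_cdf_apply (Z := fun x => gaussianReal (m * x) v) (fun _ => inferInstance)
    (measurable_gaussianReal.comp ((measurable_id.const_mul m).prodMk measurable_const)) a

lemma cdf_iterate_predictStep (ρ : ℝ) {σ c : ℝ} (hσ : 0 < σ) (hc : 0 < c) (k : ℕ) :
    ∃ (b m : ℝ) (v : NNReal), c ≤ b ∧ b ≤ c + ρ ^ 2 / σ ^ 2 ∧ σ ^ 2 ≤ v ∧
      v + m ^ 2 / b ≤ σ ^ 2 + ρ ^ 2 / c ∧ m ^ 2 / b ≤ ρ ^ 2 / c * ((1 + c * σ ^ 2)⁻¹) ^ k ∧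
      ∀ (μ : Measure ℝ) [IsProbabilityMeasure μ],
        (∀ a, cdf ((predictStep ρ σ c)^[k + 1] μ) a * ∫ x, potential b x ∂μ =
          ∫ x, potential b x * cdf (gaussianReal (m * x) v) a ∂μ) ∧
        ∀ β, 0 ≤ β → (∫ x, potential β x ∂(predictStep ρ σ c)^[k + 1] μ) * ∫ x, potential b x ∂μ =
          ∫ x, potential b x * ∫ y, potential β y ∂gaussianReal (m * x) v ∂μ := by
  obtain ⟨b, m, v, hcb, hbB, hv, hs, hn, h⟩ := lintegral_iterate_predictStep ρ hσ hc k
  have hb : 0 ≤ b := hc.le.trans hcb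
  refine ⟨b, m, v, hcb, hbB, hv, hs, hn, fun μ _ => ?_⟩
  have := isProbabilityMeasure_iterate ρ σ hc.le μ (k + 1)
  refine ⟨fun a => ?_, fun β hβ => ?_⟩
  · have hI : Measurable ((Iic a).indicator fun _ : ℝ => (1 : ℝ)) :=
      measurable_const.indicator measurableSet_Iic
    have h0 : ∀ x, 0 ≤ (Iic a).indicator (fun _ : ℝ => (1 : ℝ)) x :=
      fun x => indicator_nonneg (fun _ _ => zero_le_one) x
    rw [cdf_eq_integral]
    refine integral_eq_of_lintegral_eq (fun x => cdf_nonneg _ _)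
      (measurable_cdf_gaussianReal m v a) h0 hI ?_
    rw [h μ _ (by fun_prop)]
    simp_rw [lintegral_indicator_Iic]
  · have hE : ∀ x, ∫⁻ y, ENNReal.ofReal (potential β y) ∂gaussianReal (m * x) v =
        ENNReal.ofReal (∫ y, potential β y ∂gaussianReal (m * x) v) := fun x =>
      (ofReal_integral_eq_lintegral_ofReal (integrable_potential hβ _)
        (Eventually.of_forall fun y => (potential_pos β y).le)).symm
    have hmeas : Measurable fun x => ∫ y, potential β y ∂gaussianReal (m * x) v := by
      have := (measurable_lintegral_gaussianReal m v
        (f := fun y => ENNReal.ofReal (potential β y)) (by fun_prop)).ennreal_toReal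
      simp_rw [hE] at this
      convert this using 2 with x
      rw [ENNReal.toReal_ofReal (integral_nonneg fun y => (potential_pos β y).le)]
    refine integral_eq_of_lintegral_eq (fun x => integral_nonneg fun y => (potential_pos β y).le)
      hmeas (fun x => (potential_pos β x).le) (by fun_prop) ?_
    rw [h μ _ (by fun_prop)]
    simp_rw [hE]

/-! ### Lipschitz estimates in Kolmogorov distance -/

/-- Integrability of both h and h' forces h to tend to 0 at +∞, so h is the tail integral of -h'. -/
lemma abs_integral_sub_integral_le_of_hasDerivAt {μ ν : Measure ℝ} [IsProbabilityMeasure μ]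
    [IsProbabilityMeasure ν] {D : ℝ} (hD : ∀ a, |cdf μ a - cdf ν a| ≤ D) {h h' : ℝ → ℝ}
    (hd : ∀ x, HasDerivAt h (h' x) x) (hi : Integrable h) (hi' : Integrable h') :
    |∫ x, h x ∂μ - ∫ x, h x ∂ν| ≤ D * ∫ y, |h' y| := by
  have hlim : Tendsto h atTop (𝓝 0) :=
    tendsto_zero_of_hasDerivAt_of_integrableOn_Ioi (a := 0) (fun x _ => hd x)
      hi'.integrableOn hi.integrableOn
  have := abs_integral_sub_integral_le hD (g := fun x => -h' x) (h := h) hi'.neg fun x => by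
    rw [integral_neg, integral_Ici_eq_integral_Ioi, integral_Ioi_of_hasDerivAt_of_tendsto
      (hd x).continuousAt.continuousWithinAt (fun y _ => hd y) hi'.integrableOn hlim]
    ring
  simpa only [abs_neg] using this

lemma hasDerivAt_potential (b x : ℝ) : HasDerivAt (potential b) (-(b * x) * potential b x) x := by
  have h : HasDerivAt (fun y : ℝ => -b * y ^ 2 / 2) (-(b * x)) x := by
    have := ((hasDerivAt_pow 2 x).const_mul (-b)).div_const 2
    refine this.congr_deriv ?_
    push_cast
    ring
  exact h.exp.congr_deriv (mul_comm _ _)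

/-- Half of the Gaussian decay absorbs the polynomial factor, through e^t ≥ 1 + t. It yields a
dominating function depending on c only, which serves every b ≥ c. -/
lemma one_add_sq_mul_potential_le {c : ℝ} (hc : 0 < c) (x : ℝ) :
    (1 + x ^ 2) * potential c x ≤ (1 + 4 / c) * potential (c / 2) x := by
  have h1 : potential c x = potential (c / 2) x * potential (c / 2) x := by
    rw [potential_mul]
    congr 1
    ring
  have h2 : (1 + x ^ 2) * potential (c / 2) x ≤ 1 + 4 / c := by
    have h3 : 1 + c * x ^ 2 / 4 ≤ Real.exp (c * x ^ 2 / 4) := by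
      linarith [Real.add_one_le_exp (c * x ^ 2 / 4)]
    have h4 : Real.exp (c * x ^ 2 / 4) * potential (c / 2) x = 1 := by
      rw [potential, ← Real.exp_add]
      simp
      ring
    have h5 : 1 + x ^ 2 ≤ (1 + 4 / c) * (1 + c * x ^ 2 / 4) := by
      have : (1 + 4 / c) * (1 + c * x ^ 2 / 4) = 1 + x ^ 2 + (4 / c + c * x ^ 2 / 4) := by
        field_simp
        ring
      have : 0 ≤ 4 / c + c * x ^ 2 / 4 := by positivity
      linarith
    calc (1 + x ^ 2) * potential (c / 2) x
        ≤ (1 + 4 / c) * Real.exp (c * x ^ 2 / 4) * potential (c / 2) x := by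
          refine mul_le_mul_of_nonneg_right (h5.trans ?_) (potential_pos _ _).le
          exact mul_le_mul_of_nonneg_left h3 (by positivity)
      _ = 1 + 4 / c := by rw [mul_assoc, h4, mul_one]
  rw [h1, ← mul_assoc]
  exact mul_le_mul_of_nonneg_right h2 (potential_pos _ _).le

lemma integrable_potential_volume {b : ℝ} (hb : 0 < b) : Integrable (potential b) := by
  have := integrable_exp_neg_mul_sq (b := b / 2) (by positivity)
  refine this.congr (Eventually.of_forall fun x => ?_)
  simp only [potential]
  congr 1
  ring

lemma integrable_of_abs_le_one_add_sq_mul_potential {c K : ℝ} (hc : 0 < c) {f : ℝ → ℝ}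
    (hf : Continuous f) (h : ∀ x, |f x| ≤ K * ((1 + x ^ 2) * potential c x)) (hK : 0 ≤ K) :
    Integrable f ∧ ∫ x, |f x| ≤ K * ((1 + 4 / c) * ∫ x, potential (c / 2) x) := by
  have hi := ((integrable_potential_volume (half_pos hc)).const_mul (1 + 4 / c)).const_mul K
  have hle : ∀ x, |f x| ≤ K * ((1 + 4 / c) * potential (c / 2) x) := fun x =>
    (h x).trans (mul_le_mul_of_nonneg_left (one_add_sq_mul_potential_le hc x) hK)
  have hfi : Integrable f := hi.mono' hf.aestronglyMeasurable (Eventually.of_forall hle)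
  refine ⟨hfi, (integral_mono hfi.abs hi hle).trans_eq ?_⟩
  rw [integral_const_mul, integral_const_mul]

lemma abs_le_one_add_sq (x : ℝ) : |x| ≤ 1 + x ^ 2 := by
  rw [← sq_abs x]
  nlinarith [sq_nonneg (|x| - 1), abs_nonneg x]

lemma integrable_deriv_potential {b : ℝ} (hb : 0 < b) :
    Integrable fun x => -(b * x) * potential b x := by
  refine (integrable_of_abs_le_one_add_sq_mul_potential hb (K := b) (by fun_prop) (fun x => ?_)
    hb.le).1
  rw [abs_mul, abs_neg, abs_mul, abs_of_pos hb, abs_of_pos (potential_pos b x), ← mul_assoc]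
  have := abs_le_one_add_sq x
  have := (potential_pos b x).le
  gcongr

lemma exists_abs_integral_potential_sub_le {b : ℝ} (hb : 0 < b) :
    ∃ K, 0 < K ∧ ∀ (μ ν : Measure ℝ) [IsProbabilityMeasure μ] [IsProbabilityMeasure ν] (D : ℝ),
      (∀ a, |cdf μ a - cdf ν a| ≤ D) →
        |∫ x, potential b x ∂μ - ∫ x, potential b x ∂ν| ≤ K * D ∧
        ∀ a, |∫ x, potential b x * (Iic a).indicator (fun _ => (1 : ℝ)) x ∂μ -
          ∫ x, potential b x * (Iic a).indicator (fun _ => (1 : ℝ)) x ∂ν| ≤ K * D := by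
  have hi := integrable_deriv_potential hb
  set I := ∫ x, |-(b * x) * potential b x| with hI
  have hI0 : 0 ≤ I := integral_nonneg fun x => abs_nonneg _
  refine ⟨1 + I, by positivity, fun μ ν _ _ D hD => ?_⟩
  have hD0 : 0 ≤ D := (abs_nonneg _).trans (hD 0)
  constructor
  · have := abs_integral_sub_integral_le_of_hasDerivAt hD (hasDerivAt_potential b)
      (integrable_potential_volume hb) hi
    rw [← hI] at this
    linarith
  · intro a
    set g : ℝ → ℝ := (Iic a).indicator fun y => b * y * potential b y with hg
    have hgi : Integrable g := by
      refine Integrable.indicator (hi.neg.congr (Eventually.of_forall fun y => ?_))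
        measurableSet_Iic
      simp
    have hgI : ∫ y, |g y| ≤ I := by
      refine integral_mono hgi.abs hi.abs fun y => ?_
      by_cases hy : y ∈ Iic a
      · simp [hg, hy]
      · simp only [hg, indicator_of_notMem hy, abs_zero]
        positivity
    have hker := abs_integral_sub_integral_le hD hgi (h := fun x => ∫ y in Ici x, g y) fun _ => rfl
    -- Truncation at a creates a jump there: the smooth part is a tail integral, handled by parts,
    -- and the jump is a multiple of an indicator whose integral is the cdf at a.
    have hdec : ∀ x, potential b x * (Iic a).indicator (fun _ => (1 : ℝ)) x =
        (∫ y in Ici x, g y) + potential b a * (Iic a).indicator (fun _ => (1 : ℝ)) x := by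
      intro x
      rw [hg, setIntegral_indicator measurableSet_Iic, Ici_inter_Iic]
      by_cases hx : x ≤ a
      · rw [integral_Icc_eq_integral_Ioc, ← intervalIntegral.integral_of_le hx,
          intervalIntegral.integral_eq_sub_of_hasDerivAt (f := fun x => -potential b x)
            (fun y _ => (hasDerivAt_potential b y).fun_neg.congr_deriv (by ring))
            ((by fun_prop : Continuous fun y => b * y * potential b y).intervalIntegrable _ _)]
        simp [hx]
      · simp [hx]
    have hint : ∀ π : Measure ℝ, [IsProbabilityMeasure π] →
        ∫ x, potential b x * (Iic a).indicator (fun _ => (1 : ℝ)) x ∂π =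
          (∫ x, (∫ y in Ici x, g y) ∂π) + potential b a * cdf π a := by
      intro π _
      simp_rw [hdec]
      rw [integral_add (integral_integral_Ici π hgi).1
        (((integrable_const _).indicator measurableSet_Iic).const_mul _), integral_const_mul,
        ← cdf_eq_integral]
    rw [hint μ, hint ν]
    have h1 : |potential b a * cdf μ a - potential b a * cdf ν a| ≤ D := by
      rw [← mul_sub, abs_mul, abs_of_pos (potential_pos b a)]
      exact (mul_le_of_le_one_left (abs_nonneg _) (potential_le_one hb.le a)).trans (hD a)
    have h2 := hker.trans (mul_le_mul_of_nonneg_left hgI hD0)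
    rw [abs_le] at *
    constructor <;> linarith [h1.1, h1.2, h2.1, h2.2]

/-- Both updates are ratios p = (pA)/A and θ = (θB)/B. In (p - θ)A = (pA - θB) - θ(A - B) both terms
are O(D) since θ ≤ 1, so only the mass A of μ must be bounded below. -/
lemma exists_abs_cdf_bayesUpdate_sub_le {c δ : ℝ} (hc : 0 < c) (hδ : 0 < δ) :
    ∃ K, 0 < K ∧ ∀ (μ ν : Measure ℝ) [IsProbabilityMeasure μ] [IsProbabilityMeasure ν] (D : ℝ),
      (∀ a, |cdf μ a - cdf ν a| ≤ D) → δ ≤ ∫ x, potential c x ∂μ →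
        ∀ a, |cdf (bayesUpdate c μ) a - cdf (bayesUpdate c ν) a| ≤ K * D := by
  obtain ⟨K, hK, h⟩ := exists_abs_integral_potential_sub_le hc
  refine ⟨2 * K / δ, by positivity, fun μ ν _ _ D hD hμ a => ?_⟩
  obtain ⟨h1, h2⟩ := h μ ν D hD
  have h2 := h2 a
  rw [← cdf_bayesUpdate hc.le μ a, ← cdf_bayesUpdate hc.le ν a] at h2
  set p := cdf (bayesUpdate c μ) a
  set θ := cdf (bayesUpdate c ν) a with hθ
  set A := ∫ x, potential c x ∂μ
  set B := ∫ x, potential c x ∂ν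
  have hD0 : 0 ≤ D := (abs_nonneg _).trans (hD 0)
  have h3 : |(p - θ) * A| ≤ 2 * (K * D) := by
    have : (p - θ) * A = (p * A - θ * B) - θ * (A - B) := by ring
    rw [this]
    refine (abs_sub _ _).trans ?_
    have : |θ * (A - B)| ≤ K * D := by
      rw [abs_mul, abs_of_nonneg (cdf_nonneg _ a)]
      exact (mul_le_of_le_one_left (abs_nonneg _) (cdf_le_one _ a)).trans h1
    linarith
  rw [abs_mul, abs_of_pos (hδ.trans_le hμ)] at h3
  have h4 : |p - θ| * δ ≤ 2 * (K * D) :=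
    (mul_le_mul_of_nonneg_left hμ (abs_nonneg _)).trans h3
  rw [div_mul_eq_mul_div, le_div_iff₀ hδ]
  linarith

lemma hasDerivAt_cdf_gaussianReal (m : ℝ) {v : NNReal} (hv : v ≠ 0) (a x : ℝ) :
    HasDerivAt (fun x => cdf (gaussianReal (m * x) v) a)
      (-m * gaussianPDFReal (m * x) v a) x := by
  have hcdf : ∀ u, cdf (gaussianReal 0 v) u = ∫ y in Iic u, gaussianPDFReal 0 v y := by
    intro u
    rw [cdf_eq_real, measureReal_def, gaussianReal_apply_eq_integral _ hv, ENNReal.toReal_ofReal]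
    exact integral_nonneg fun y => gaussianPDFReal_nonneg _ _ _
  have hcont : Continuous (gaussianPDFReal 0 v) := by
    unfold gaussianPDFReal
    fun_prop
  have hΦ : ∀ u, HasDerivAt (fun u => cdf (gaussianReal 0 v) u) (gaussianPDFReal 0 v u) u := by
    intro u
    have h1 : (fun u => cdf (gaussianReal 0 v) u) = fun u =>
        (∫ y in (0 : ℝ)..u, gaussianPDFReal 0 v y) + cdf (gaussianReal 0 v) 0 := by
      ext u
      rw [hcdf, hcdf, ← intervalIntegral.integral_Iic_sub_Iic
        (integrable_gaussianPDFReal 0 v).integrableOn (integrable_gaussianPDFReal 0 v).integrableOn]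
      ring
    rw [h1]
    exact (intervalIntegral.integral_hasDerivAt_right
      (integrable_gaussianPDFReal 0 v).intervalIntegrable
      (hcont.stronglyMeasurableAtFilter _ _) hcont.continuousAt).add_const _
  have h2 : (fun x => cdf (gaussianReal (m * x) v) a) = fun x =>
      cdf (gaussianReal 0 v) (a - m * x) := by
    ext x
    rw [cdf_eq_real, cdf_eq_real]
    have : gaussianReal (m * x) v = (gaussianReal 0 v).map (m * x + ·) := by
      rw [gaussianReal_map_const_add, zero_add]
    rw [this, map_measureReal_apply (by fun_prop) measurableSet_Iic]
    congr 1
    ext y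
    simp only [mem_preimage, mem_Iic]
    constructor <;> intro h <;> linarith
  have h3 : gaussianPDFReal 0 v (a - m * x) = gaussianPDFReal (m * x) v a := by
    simp [gaussianPDFReal]
  rw [h2, ← h3, mul_comm]
  have h4 : HasDerivAt (fun x => a - m * x) (-m) x := by
    simpa using ((hasDerivAt_id x).const_mul m).const_sub a
  exact (hΦ (a - m * x)).comp x h4

lemma gaussianPDFReal_le {σ : ℝ} (hσ : 0 < σ) {v : NNReal} (hv : σ ^ 2 ≤ v) (p a : ℝ) :
    gaussianPDFReal p v a ≤ σ⁻¹ := by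
  have h1 : σ ≤ √(2 * Real.pi * v) := by
    refine Real.le_sqrt_of_sq_le ?_
    nlinarith [Real.pi_gt_three, sq_nonneg σ]
  have h2 : Real.exp (-(a - p) ^ 2 / (2 * v)) ≤ 1 := by
    rw [Real.exp_le_one_iff, neg_div, neg_nonpos]
    positivity
  rw [gaussianPDFReal]
  calc (√(2 * Real.pi * v))⁻¹ * Real.exp (-(a - p) ^ 2 / (2 * v)) ≤ σ⁻¹ * 1 := by gcongr
    _ = σ⁻¹ := mul_one _

/-- Two probability measures tilted by `potential b` and pushed through a Gaussian kernel with
slope `m` are at Kolmogorov distance of order `|m|` times their initial distance. -/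
lemma exists_abs_tilted_sub_le {c B σ δ : ℝ} (hc : 0 < c) (hcB : c ≤ B) (hσ : 0 < σ)
    (hδ : 0 < δ) :
    ∃ K, 0 < K ∧ ∀ (b m : ℝ) (v : NNReal), c ≤ b → b ≤ B → σ ^ 2 ≤ v →
      ∀ (μ ν : Measure ℝ) [IsProbabilityMeasure μ] [IsProbabilityMeasure ν] (D : ℝ),
      (∀ a, |cdf μ a - cdf ν a| ≤ D) → δ ≤ ∫ x, potential b x ∂μ → δ ≤ ∫ x, potential b x ∂ν →
      ∀ a p θ : ℝ,
        p * ∫ x, potential b x ∂μ = ∫ x, potential b x * cdf (gaussianReal (m * x) v) a ∂μ →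
        θ * ∫ x, potential b x ∂ν = ∫ x, potential b x * cdf (gaussianReal (m * x) v) a ∂ν →
        |p - θ| ≤ K * |m| * D := by
  set K₁ := (1 + 4 / c) / δ with hK₁
  set I := (1 + 4 / c) * ∫ x, potential (c / 2) x with hI
  have hI0 : 0 ≤ I := mul_nonneg (by positivity) (integral_nonneg fun x => (potential_pos _ _).le)
  have hB : 0 < B := hc.trans_le hcB
  have hK₁0 : 0 < K₁ := by positivity
  refine ⟨σ⁻¹ * (B * (1 + K₁) + 1) * (I + 1) / δ, by positivity, ?_⟩
  intro b m v hcb hbB hv μ ν _ _ D hD hμ hν a p θ hp hθ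
  have hb : 0 < b := hc.trans_le hcb
  have hv0 : v ≠ 0 := by
    rintro rfl
    have : 0 < σ ^ 2 := by positivity
    simp at hv
    linarith
  have hD0 : 0 ≤ D := (abs_nonneg _).trans (hD 0)
  set g : ℝ → ℝ := fun x => cdf (gaussianReal (m * x) v) a with hg
  have hgd : ∀ x, HasDerivAt g (-m * gaussianPDFReal (m * x) v a) x :=
    hasDerivAt_cdf_gaussianReal m hv0 a
  have hgc : Continuous g := continuous_iff_continuousAt.2 fun x => (hgd x).continuousAt
  have hg'c : Continuous fun x => -m * gaussianPDFReal (m * x) v a := by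
    unfold gaussianPDFReal
    fun_prop
  have hg' : ∀ x, |(-m * gaussianPDFReal (m * x) v a)| ≤ σ⁻¹ * |m| := by
    intro x
    rw [abs_mul, abs_neg, abs_of_nonneg (gaussianPDFReal_nonneg _ _ _), mul_comm]
    exact mul_le_mul_of_nonneg_right (gaussianPDFReal_le hσ hv _ _) (abs_nonneg m)
  have hlip : ∀ x y, |g x - g y| ≤ σ⁻¹ * |m| * |x - y| := by
    intro x y
    exact Convex.norm_image_sub_le_of_norm_hasDerivWithin_le (𝕜 := ℝ) (s := univ)
      (fun z _ => (hgd z).hasDerivWithinAt) (fun z _ => hg' z) convex_univ (mem_univ y) (mem_univ x)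
  have hwg : ∀ π : Measure ℝ, [IsProbabilityMeasure π] →
      Integrable (fun x => potential b x * g x) π := by
    intro π _
    refine (integrable_potential hb.le π).mul_bdd (c := 1) hgc.aestronglyMeasurable
      (Eventually.of_forall fun x => ?_)
    rw [Real.norm_of_nonneg (cdf_nonneg _ _)]
    exact cdf_le_one _ _
  have hwabs : ∀ y, potential b y * |y| ≤ 1 + 4 / c := by
    intro y
    have h1 := one_add_sq_mul_potential_le hc y
    have h2 := potential_le_one (half_pos hc).le y
    have h3 : (1 + 4 / c) * potential (c / 2) y ≤ 1 + 4 / c :=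
      mul_le_of_le_one_right (by positivity) h2
    have h4 : potential b y * |y| ≤ potential c y * (1 + y ^ 2) :=
      mul_le_mul (potential_anti hcb y) (abs_le_one_add_sq y) (abs_nonneg y) (potential_pos c y).le
    linarith
  -- θ is a `potential b`-weighted ν-average of g, and g is Lipschitz with constant σ⁻¹ |m|; the
  -- first absolute moment of the weight is bounded.
  have hbound : ∀ x, |g x - θ| ≤ σ⁻¹ * |m| * (|x| + K₁) := by
    intro x
    set A := ∫ y, potential b y ∂ν
    have hA : 0 < A := hδ.trans_le hν
    have h1 : (g x - θ) * A = ∫ y, potential b y * (g x - g y) ∂ν := by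
      simp_rw [mul_sub]
      rw [integral_sub ((integrable_potential hb.le ν).mul_const _) (hwg ν), integral_mul_const,
        ← hθ]
      ring
    have h2 : |∫ y, potential b y * (g x - g y) ∂ν| ≤
        ∫ y, (σ⁻¹ * |m| * |x| * potential b y + σ⁻¹ * |m| * (1 + 4 / c)) ∂ν := by
      rw [← Real.norm_eq_abs]
      refine norm_integral_le_of_norm_le (((integrable_potential hb.le ν).const_mul _).add
        (integrable_const _)) (Eventually.of_forall fun y => ?_)
      rw [Real.norm_eq_abs, abs_mul, abs_of_pos (potential_pos b y)]
      have h3 : |g x - g y| ≤ σ⁻¹ * |m| * (|x| + |y|) :=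
        (hlip x y).trans (mul_le_mul_of_nonneg_left (abs_sub x y) (by positivity))
      have h4 := mul_le_mul_of_nonneg_left h3 (potential_pos b y).le
      have h5 := mul_le_mul_of_nonneg_left (hwabs y) (by positivity : 0 ≤ σ⁻¹ * |m|)
      linarith
    rw [← h1, abs_mul, abs_of_pos hA, integral_add ((integrable_potential hb.le ν).const_mul _)
      (integrable_const _), integral_const_mul, integral_const] at h2
    simp only [probReal_univ, one_smul] at h2
    have h6 : 1 + 4 / c ≤ K₁ * A := by
      have : K₁ * δ = 1 + 4 / c := by rw [hK₁]; field_simp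
      rw [← this]
      exact mul_le_mul_of_nonneg_left hν hK₁0.le
    refine le_of_mul_le_mul_right (h2.trans ?_) hA
    have := mul_le_mul_of_nonneg_left h6 (by positivity : 0 ≤ σ⁻¹ * |m|)
    linarith
  -- Centring at θ makes the ν-integral of h vanish and its μ-integral equal (p - θ) times the mass.
  -- It also puts a factor |m| in both terms of h', including the one where the weight is
  -- differentiated; this is the source of the contraction.
  set h : ℝ → ℝ := fun x => potential b x * (g x - θ) with hh
  set h' : ℝ → ℝ := fun x => -(b * x) * potential b x * (g x - θ) +
    potential b x * (-m * gaussianPDFReal (m * x) v a) with hh'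
  have hd : ∀ x, HasDerivAt h (h' x) x := fun x =>
    (hasDerivAt_potential b x).mul ((hgd x).sub_const θ)
  have hhc : Continuous h := by fun_prop
  have hh'c : Continuous h' := by fun_prop
  have habs : ∀ x : ℝ, |x| + K₁ ≤ (1 + K₁) * (1 + x ^ 2) := by
    intro x
    have := abs_le_one_add_sq x
    have : 0 ≤ K₁ * x ^ 2 := by positivity
    linarith
  have habs' : ∀ x : ℝ, |x| * (|x| + K₁) ≤ (1 + K₁) * (1 + x ^ 2) := by
    intro x
    have h1 := mul_le_mul_of_nonneg_left (abs_le_one_add_sq x) hK₁0.le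
    have h2 : |x| * |x| = x ^ 2 := by rw [← sq_abs]; ring
    have h3 : |x| * (|x| + K₁) = x ^ 2 + K₁ * |x| := by rw [mul_add, h2]; ring
    linarith
  have hhi : Integrable h := by
    refine (integrable_of_abs_le_one_add_sq_mul_potential hc hhc
      (K := σ⁻¹ * |m| * (1 + K₁)) (fun x => ?_) (by positivity)).1
    rw [hh, abs_mul, abs_of_pos (potential_pos b x)]
    calc potential b x * |g x - θ| ≤ potential c x * (σ⁻¹ * |m| * ((1 + K₁) * (1 + x ^ 2))) := by
          refine mul_le_mul (potential_anti hcb x) ((hbound x).trans ?_) (abs_nonneg _)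
            (potential_pos c x).le
          exact mul_le_mul_of_nonneg_left (habs x) (by positivity)
      _ = _ := by ring
  have hhi' := integrable_of_abs_le_one_add_sq_mul_potential hc hh'c
    (K := σ⁻¹ * |m| * (B * (1 + K₁) + 1)) (fun x => by
      have e1 : |-(b * x) * potential b x * (g x - θ)| ≤
          potential c x * (σ⁻¹ * |m| * (B * ((1 + K₁) * (1 + x ^ 2)))) := by
        rw [abs_mul, abs_mul, abs_neg, abs_mul, abs_of_pos hb, abs_of_pos (potential_pos b x)]
        calc b * |x| * potential b x * |g x - θ|
            ≤ B * |x| * potential c x * (σ⁻¹ * |m| * (|x| + K₁)) := by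
              gcongr
              · exact mul_nonneg (by positivity) (potential_pos c x).le
              · exact (potential_pos b x).le
              · exact potential_anti hcb x
              · exact hbound x
          _ = potential c x * (σ⁻¹ * |m| * (B * (|x| * (|x| + K₁)))) := by ring
          _ ≤ _ := by
              have := (potential_pos c x).le
              exact mul_le_mul_of_nonneg_left (mul_le_mul_of_nonneg_left
                (mul_le_mul_of_nonneg_left (habs' x) hB.le) (by positivity)) this
      have e2 : |potential b x * (-m * gaussianPDFReal (m * x) v a)| ≤
          potential c x * (σ⁻¹ * |m| * (1 + x ^ 2)) := by
        rw [abs_mul, abs_of_pos (potential_pos b x)]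
        refine mul_le_mul (potential_anti hcb x) ((hg' x).trans ?_) (abs_nonneg _)
          (potential_pos c x).le
        exact le_mul_of_one_le_right (by positivity) (by nlinarith [sq_nonneg x])
      calc |h' x| ≤ _ := abs_add_le _ _
        _ ≤ _ := add_le_add e1 e2
        _ = _ := by ring) (by positivity)
  have key := abs_integral_sub_integral_le_of_hasDerivAt hD hd hhi hhi'.1
  have hval : ∀ π : Measure ℝ, [IsProbabilityMeasure π] → ∫ x, h x ∂π =
      ∫ x, potential b x * g x ∂π - θ * ∫ x, potential b x ∂π := by
    intro π _
    simp_rw [hh, mul_sub]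
    rw [integral_sub (hwg π) ((integrable_potential hb.le π).mul_const _), integral_mul_const]
    ring
  rw [hval μ, hval ν, ← hp, ← hθ, sub_self, sub_zero, ← sub_mul, abs_mul,
    abs_of_pos (hδ.trans_le hμ)] at key
  have h1 : |p - θ| * δ ≤ D * (σ⁻¹ * |m| * (B * (1 + K₁) + 1) * I) :=
    (mul_le_mul_of_nonneg_left hμ (abs_nonneg _)).trans
      (key.trans (mul_le_mul_of_nonneg_left hhi'.2 hD0))
  rw [div_mul_eq_mul_div, div_mul_eq_mul_div, le_div_iff₀ hδ]
  refine h1.trans ?_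
  have : 0 ≤ D * (σ⁻¹ * |m| * (B * (1 + K₁) + 1)) := by positivity
  linarith

/-! ### Stability of the filter and propagation of local errors -/

/-- The rate is the geometric decay of m. Mass is measured with the largest exponent, since
`potential B` lies below every `potential b` that can occur. -/
lemma exists_abs_cdf_iterate_sub_le (ρ : ℝ) {σ c δ : ℝ} (hσ : 0 < σ) (hc : 0 < c) (hδ : 0 < δ) :
    ∃ K r, 0 < K ∧ 0 < r ∧ r < 1 ∧ ∀ (k : ℕ) (μ ν : Measure ℝ) [IsProbabilityMeasure μ]
      [IsProbabilityMeasure ν] (D : ℝ), (∀ a, |cdf μ a - cdf ν a| ≤ D) →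
      δ ≤ ∫ x, potential (c + ρ ^ 2 / σ ^ 2) x ∂μ → δ ≤ ∫ x, potential (c + ρ ^ 2 / σ ^ 2) x ∂ν →
      ∀ a, |cdf ((predictStep ρ σ c)^[k + 1] μ) a - cdf ((predictStep ρ σ c)^[k + 1] ν) a| ≤
        K * r ^ k * D := by
  set B := c + ρ ^ 2 / σ ^ 2 with hB
  have hcB : c ≤ B := by simp only [hB, le_add_iff_nonneg_right]; positivity
  have hB0 : 0 < B := hc.trans_le hcB
  obtain ⟨K, hK, h⟩ := exists_abs_tilted_sub_le hc hcB hσ hδ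
  have hγ : 1 < 1 + c * σ ^ 2 := by simp; positivity
  -- The square root turns decay of m² into decay of |m|; the +1 keeps the constant positive when ρ
  -- = 0.
  refine ⟨K * (√(B * (ρ ^ 2 / c)) + 1), √((1 + c * σ ^ 2)⁻¹), by positivity, by positivity, ?_, ?_⟩
  · rw [Real.sqrt_lt' one_pos, one_pow]
    exact inv_lt_one_of_one_lt₀ hγ
  intro k μ ν _ _ D hD hμ hν a
  have hD0 : 0 ≤ D := (abs_nonneg _).trans (hD 0)
  obtain ⟨b, m, v, hcb, hbB, hv, -, hn, hF⟩ := cdf_iterate_predictStep ρ hσ hc k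
  have hb : 0 < b := hc.trans_le hcb
  have hmono : ∀ π : Measure ℝ, [IsProbabilityMeasure π] →
      ∫ x, potential B x ∂π ≤ ∫ x, potential b x ∂π := fun π _ =>
    integral_mono (integrable_potential hB0.le π) (integrable_potential hb.le π)
      fun x => potential_anti hbB x
  have h1 := h b m v hcb hbB hv μ ν D hD (hμ.trans (hmono μ)) (hν.trans (hmono ν)) a _ _
    ((hF μ).1 a) ((hF ν).1 a)
  have hm : |m| ≤ √(B * (ρ ^ 2 / c)) * √((1 + c * σ ^ 2)⁻¹) ^ k := by
    refine abs_le_of_sq_le_sq ?_ (by positivity)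
    rw [mul_pow, Real.sq_sqrt (by positivity), ← pow_mul, mul_comm k, pow_mul,
      Real.sq_sqrt (by positivity)]
    rw [div_le_iff₀ hb] at hn
    refine hn.trans ?_
    rw [mul_comm, mul_assoc B]
    exact mul_le_mul_of_nonneg_right hbB (by positivity)
  refine h1.trans (mul_le_mul_of_nonneg_right ?_ hD0)
  rw [mul_assoc K]
  refine mul_le_mul_of_nonneg_left (hm.trans ?_) hK.le
  exact mul_le_mul_of_nonneg_right (by linarith) (by positivity)

lemma integral_potential_pos {b : ℝ} (hb : 0 ≤ b) (μ : Measure ℝ) [IsProbabilityMeasure μ] :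
    0 < ∫ x, potential b x ∂μ := by
  refine (integral_pos_iff_support_of_nonneg (fun x => (potential_pos b x).le)
    (integrable_potential hb μ)).2 ?_
  have : Function.support (potential b) = univ :=
    eq_univ_of_forall fun x => (potential_pos b x).ne'
  simp [this]

lemma integral_potential_le_one {b : ℝ} (hb : 0 ≤ b) (μ : Measure ℝ) [IsProbabilityMeasure μ] :
    ∫ x, potential b x ∂μ ≤ 1 := by
  refine (integral_mono (integrable_potential hb μ) (integrable_const 1)
    fun x => potential_le_one hb x).trans_eq ?_
  simp

lemma le_integral_potential_gaussianReal {β : ℝ} (hβ : 0 ≤ β) (p : ℝ) {v : NNReal} (hv : v ≠ 0) :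
    (√(1 + β * v))⁻¹ * potential β p ≤ ∫ y, potential β y ∂gaussianReal p v := by
  have h := lintegral_potential_gaussianReal hβ p hv (f := 1) measurable_one
  simp only [Pi.one_apply, mul_one, lintegral_one, measure_univ] at h
  have hpos := (potential_pos (β / (1 + β * v)) p).le
  rw [integral_eq_lintegral_of_nonneg_ae (Eventually.of_forall fun y => (potential_pos β y).le)
    (by fun_prop), h, ENNReal.toReal_ofReal (by positivity)]
  refine mul_le_mul_of_nonneg_left (potential_anti ?_ p) (by positivity)
  exact div_le_self hβ (by simp; positivity)

/-- The exact predictive distributions do not escape to infinity. -/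
lemma exists_le_integral_potential_iterate (ρ : ℝ) {σ c β : ℝ} (hσ : 0 < σ) (hc : 0 < c)
    (hβ : 0 < β) (η : Measure ℝ) [IsProbabilityMeasure η] :
    ∃ δ, 0 < δ ∧ ∀ k, δ ≤ ∫ x, potential β x ∂(predictStep ρ σ c)^[k] η := by
  set B := c + ρ ^ 2 / σ ^ 2 with hB
  have hB0 : 0 < B := by positivity
  set S := σ ^ 2 + ρ ^ 2 / c with hS
  have hS0 : 0 < S := by positivity
  -- Worst case of the closed form: b ≤ B, v ≤ S and m² ≤ B S. The normalizing mass is at most 1 and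
  -- can be discarded.
  set δ := (√(1 + β * S))⁻¹ * ∫ x, potential (B + β * (B * S)) x ∂η with hδ
  have hδ0 : 0 < δ := mul_pos (by positivity) (integral_potential_pos (by positivity) η)
  refine ⟨min δ (∫ x, potential β x ∂η), lt_min hδ0 (integral_potential_pos hβ.le η), ?_⟩
  rintro (_ | k)
  · exact min_le_right _ _
  refine (min_le_left _ _).trans ?_
  obtain ⟨b, m, v, hcb, hbB, hv, hs, -, hF⟩ := cdf_iterate_predictStep ρ hσ hc k
  have hb : 0 < b := hc.trans_le hcb
  have hmb : 0 ≤ m ^ 2 / b := by positivity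
  have hvS : (v : ℝ) ≤ S := by linarith
  have hv0 : v ≠ 0 := by
    rintro rfl
    have : 0 < σ ^ 2 := by positivity
    simp at hv
    linarith
  have hm : m ^ 2 ≤ B * S := by
    have h1 : m ^ 2 / b ≤ S := by linarith [v.coe_nonneg]
    rw [div_le_iff₀ hb] at h1
    nlinarith
  have hFβ := (hF η).2 β hβ.le
  have := isProbabilityMeasure_iterate ρ σ hc.le η (k + 1)
  set J := ∫ x, potential β x ∂(predictStep ρ σ c)^[k + 1] η with hJ
  have hJ0 : 0 ≤ J := integral_nonneg fun x => (potential_pos β x).le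
  have h1 : J * ∫ x, potential b x ∂η ≤ J :=
    mul_le_of_le_one_right hJ0 (integral_potential_le_one hb.le η)
  refine le_trans ?_ h1
  rw [hFβ, hδ, ← integral_const_mul]
  have hle : ∀ x, (√(1 + β * S))⁻¹ * potential (B + β * (B * S)) x ≤
      potential b x * ∫ y, potential β y ∂gaussianReal (m * x) v := by
    intro x
    have h2 := le_integral_potential_gaussianReal hβ.le (m * x) hv0
    have h3 : potential (β * (B * S)) x ≤ potential β (m * x) := by
      have : potential β (m * x) = potential (β * m ^ 2) x := by
        unfold potential
        congr 1
        ring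
      rw [this]
      exact potential_anti (mul_le_mul_of_nonneg_left hm hβ.le) x
    have h4 : (√(1 + β * S))⁻¹ ≤ (√(1 + β * v))⁻¹ := by gcongr
    rw [← potential_mul]
    calc (√(1 + β * S))⁻¹ * (potential B x * potential (β * (B * S)) x)
        = potential B x * ((√(1 + β * S))⁻¹ * potential (β * (B * S)) x) := by ring
      _ ≤ potential b x * ((√(1 + β * v))⁻¹ * potential β (m * x)) := by
          refine mul_le_mul (potential_anti hbB x) (mul_le_mul h4 h3 (potential_pos _ _).le
            (by positivity)) ?_ (potential_pos _ _).le
          exact mul_nonneg (by positivity) (potential_pos _ _).le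
      _ ≤ _ := mul_le_mul_of_nonneg_left h2 (potential_pos _ _).le
  refine integral_mono_of_nonneg (Eventually.of_forall fun x => ?_) ?_ (Eventually.of_forall hle)
  · exact mul_nonneg (by positivity) (potential_pos _ _).le
  -- A non-integrable right-hand side would have integral 0, while the closed form equates it with a
  -- product of positive numbers.
  · by_contra hni
    have h0 := integral_undef hni
    rw [h0] at hFβ
    have h5 : 0 < J := integral_potential_pos hβ.le _
    exact (mul_pos h5 (integral_potential_pos hb.le η)).ne' hFβ

/-- If at every time the approximation `μ k` is `ε`-close to the image of `μ (k - 1)` under the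
filter, then the global error is of order `ε`, uniformly in time. -/
lemma exists_uniform_error_bound (ρ : ℝ) {σ c : ℝ} (hσ : 0 < σ) (hc : 0 < c)
    (η : Measure ℝ) [IsProbabilityMeasure η] :
    ∃ C ε₀, 0 < C ∧ 0 < ε₀ ∧ ∀ (μ : ℕ → Measure ℝ), (∀ k, IsProbabilityMeasure (μ k)) →
      ∀ (ε : ℝ) (T : ℕ), ε ≤ ε₀ → (∀ a, |cdf (μ 0) a - cdf η a| ≤ ε) →
      (∀ k, k + 1 < T → ∀ a, |cdf (μ (k + 1)) a - cdf (predictStep ρ σ c (μ k)) a| ≤ ε) →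
      ∀ k < T, ∀ a, |cdf (μ k) a - cdf ((predictStep ρ σ c)^[k] η) a| ≤ C * ε ∧
        |cdf (bayesUpdate c (μ k)) a - cdf (bayesUpdate c ((predictStep ρ σ c)^[k] η)) a| ≤
          C * ε := by
  set B := c + ρ ^ 2 / σ ^ 2 with hB
  have hcB : c ≤ B := by simp only [hB, le_add_iff_nonneg_right]; positivity
  have hB0 : 0 < B := hc.trans_le hcB
  obtain ⟨δ₂, hδ₂, hη⟩ := exists_le_integral_potential_iterate ρ hσ hc hB0 η
  -- Half of the exact lower bound is given up so that nearby measures still satisfy the remaining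
  -- half.
  set δ := δ₂ / 2 with hδ
  have hδ0 : 0 < δ := by positivity
  obtain ⟨K, r, hK, hr0, hr1, hstab⟩ := exists_abs_cdf_iterate_sub_le ρ hσ hc hδ0
  obtain ⟨L, hL, hLip⟩ := exists_abs_integral_potential_sub_le hB0
  obtain ⟨U, hU, hUpd⟩ := exists_abs_cdf_bayesUpdate_sub_le hc hδ0
  have hr : 0 < 1 - r := by linarith
  set C := 1 + K / (1 - r) with hC
  have hC0 : 0 < C := by positivity
  -- C adds the current local error to the summed past ones, and U transfers the bound through the
  -- Bayes update. The threshold ensures L C ε ≤ δ, the half given up.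
  refine ⟨C + U * C, δ / (L * C), by positivity, by positivity, ?_⟩
  intro μ hμ ε T hε h0 hloc
  have hε0 : 0 ≤ ε := (abs_nonneg _).trans (h0 0)
  -- ν k is what μ k would be without its own sampling error.
  set ν : ℕ → Measure ℝ := fun k => Nat.casesOn k η fun j => predictStep ρ σ c (μ j) with hν
  have hνp : ∀ k, IsProbabilityMeasure (ν k) := by
    rintro (_ | k)
    · assumption
    · have := hμ k
      exact isProbabilityMeasure_predictStep ρ σ hc.le (μ k)
  have hloc' : ∀ k < T, ∀ a, |cdf (μ k) a - cdf (ν k) a| ≤ ε := by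
    rintro (_ | k) hk
    · exact h0
    · exact hloc k hk
  have hlow : ∀ k (π : Measure ℝ) [IsProbabilityMeasure π],
      (∀ a, |cdf π a - cdf ((predictStep ρ σ c)^[k] η) a| ≤ C * ε) →
        δ ≤ ∫ x, potential B x ∂π := by
    intro k π _ h
    have := isProbabilityMeasure_iterate ρ σ hc.le η k
    have h1 := (hLip π _ (C * ε) h).1
    have h2 : L * (C * ε) ≤ δ := by
      rw [← mul_assoc, mul_comm]
      exact (le_div_iff₀ (by positivity)).1 hε
    have h3 := hη k
    have h4 := (abs_le.1 h1).1
    linarith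
  -- The error bound and the mass bound support each other, hence the strong induction: stability
  -- from an earlier time j needs mass for μ j and ν j, which the error bounds at time j provide.
  have hmain : ∀ k < T,
      (∀ a, |cdf (μ k) a - cdf ((predictStep ρ σ c)^[k] η) a| ≤ C * ε) ∧
      (∀ a, |cdf (ν k) a - cdf ((predictStep ρ σ c)^[k] η) a| ≤ C * ε) := by
    intro k
    induction k using Nat.strong_induction_on with
    | _ k ih =>
      intro hk
      -- The local error made at time j has been contracted for the remaining i steps. The bound is
      -- a geometric tail, so passing from j to j + 1 adds exactly one term, K ε r^i.
      have htel : ∀ j i, i + j = k → ∀ a, |cdf ((predictStep ρ σ c)^[i] (ν j)) a -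
          cdf ((predictStep ρ σ c)^[k] η) a| ≤ K * ε * (r ^ i / (1 - r)) := by
        intro j
        induction j with
        | zero =>
          intro i hi a
          obtain rfl : i = k := hi
          have : ν 0 = η := rfl
          rw [this, sub_self, abs_zero]
          positivity
        | succ j ihj =>
          intro i hi a
          have hjk : j < k := by omega
          have h1 := ihj (i + 1) (by omega) a
          have := hμ j
          have := hνp j
          have hj := ih j hjk (hjk.trans hk)
          have h2 := hstab i (μ j) (ν j) ε (hloc' j (hjk.trans hk)) (hlow j _ hj.1)
            (hlow j _ hj.2) a
          have h3 : (predictStep ρ σ c)^[i] (ν (j + 1)) = (predictStep ρ σ c)^[i + 1] (μ j) := rfl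
          have h4 : K * ε * (r ^ i / (1 - r)) =
              K * r ^ i * ε + K * ε * (r ^ (i + 1) / (1 - r)) := by
            field_simp
            ring
          rw [h3, h4]
          exact (abs_sub_le _ _ _).trans (add_le_add h2 h1)
      have hk0 : ∀ a, |cdf (ν k) a - cdf ((predictStep ρ σ c)^[k] η) a| ≤
          K / (1 - r) * ε := by
        intro a
        have := htel k 0 (zero_add k) a
        rw [pow_zero] at this
        refine this.trans_eq ?_
        ring
      refine ⟨fun a => ?_, fun a => (hk0 a).trans ?_⟩
      · refine (abs_sub_le _ (cdf (ν k) a) _).trans ((add_le_add (hloc' k hk a) (hk0 a)).trans_eq ?_)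
        rw [hC]
        ring
      · exact mul_le_mul_of_nonneg_right (by rw [hC]; linarith) hε0
  intro k hk a
  have := hμ k
  have := isProbabilityMeasure_iterate ρ σ hc.le η k
  have h1 := (hmain k hk).1
  have h2 : δ ≤ ∫ x, potential c x ∂μ k := (hlow k _ h1).trans
    (integral_mono (integrable_potential hB0.le _) (integrable_potential hc.le _)
      fun x => potential_anti hcB x)
  have h3 := hUpd (μ k) _ (C * ε) h1 h2 a
  have h4 : 0 ≤ U * (C * ε) := by positivity
  have h5 : 0 ≤ C * ε := by positivity
  refine ⟨(h1 a).trans ?_, h3.trans ?_⟩ <;> linarith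

/-! ### Empirical measures -/

lemma measureReal_sum_smul_dirac {N : ℕ} {a : Fin N → ℝ} (ha : ∀ n, 0 ≤ a n) (x : Fin N → ℝ)
    {s : Set ℝ} (hs : MeasurableSet s) :
    (∑ n, ENNReal.ofReal (a n) • Measure.dirac (x n)).real s =
      ∑ n, a n * s.indicator (fun _ => (1 : ℝ)) (x n) := by
  rw [measureReal_def, Measure.finsetSum_apply, ENNReal.toReal_sum]
  · refine Finset.sum_congr rfl fun n _ => ?_
    rw [Measure.smul_apply, smul_eq_mul, ENNReal.toReal_mul, ENNReal.toReal_ofReal (ha n),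
      Measure.dirac_apply' _ hs]
    by_cases h : x n ∈ s <;> simp [h]
  · intro n _
    rw [Measure.smul_apply, smul_eq_mul]
    exact ENNReal.mul_ne_top ENNReal.ofReal_ne_top (measure_ne_top _ _)

lemma isProbabilityMeasure_sum_smul_dirac {N : ℕ} {a : Fin N → ℝ} (ha : ∀ n, 0 ≤ a n)
    (h1 : ∑ n, a n = 1) (x : Fin N → ℝ) :
    IsProbabilityMeasure (∑ n, ENNReal.ofReal (a n) • Measure.dirac (x n)) := by
  constructor
  simp only [Measure.finsetSum_apply, Measure.smul_apply, measure_univ, smul_eq_mul, mul_one]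
  rw [← ENNReal.ofReal_sum_of_nonneg fun n _ => ha n, h1, ENNReal.ofReal_one]

lemma sum_potential_pos (c : ℝ) {N : ℕ} (hN : 0 < N) (x : Fin N → ℝ) :
    0 < ∑ m, potential c (x m) :=
  Finset.sum_pos (fun _ _ => potential_pos _ _) ⟨⟨0, hN⟩, Finset.mem_univ _⟩

lemma weight_nonneg (c : ℝ) {N : ℕ} (x : Fin N → ℝ) (n : Fin N) : 0 ≤ weight c x n :=
  div_nonneg (potential_pos _ _).le (Finset.sum_nonneg fun _ _ => (potential_pos _ _).le)

lemma isProbabilityMeasure_empirical {N : ℕ} (hN : 0 < N) (x : Fin N → ℝ) :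
    IsProbabilityMeasure (empirical x) := by
  refine isProbabilityMeasure_sum_smul_dirac (fun _ => by positivity) ?_ x
  simp
  field_simp

lemma isProbabilityMeasure_weighted (c : ℝ) {N : ℕ} (hN : 0 < N) (x : Fin N → ℝ) :
    IsProbabilityMeasure (weighted c x) := by
  refine isProbabilityMeasure_sum_smul_dirac (weight_nonneg c x) ?_ x
  simp only [weight]
  rw [← Finset.sum_div, div_self (sum_potential_pos c hN x).ne']

/-- Reweighting is an exact Bayes update, so sampling is the only source of error. -/
lemma weighted_eq_bayesUpdate (c : ℝ) {N : ℕ} (hN : 0 < N) (x : Fin N → ℝ) :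
    weighted c x = bayesUpdate c (empirical x) := by
  have hZ := sum_potential_pos c hN x
  have hN' : (0 : ℝ) < N := Nat.cast_pos.2 hN
  have h : (empirical x).withDensity (fun x => ENNReal.ofReal (potential c x)) =
      ENNReal.ofReal ((∑ m, potential c (x m)) / N) • weighted c x := by
    ext s hs
    rw [withDensity_apply _ hs, ← lintegral_indicator hs]
    simp only [empirical, weighted, lintegral_finsetSum_measure, lintegral_smul_measure,
      Measure.smul_apply, Measure.finsetSum_apply, smul_eq_mul, Finset.mul_sum]
    refine Finset.sum_congr rfl fun n _ => ?_
    rw [lintegral_dirac' _ ((by fun_prop : Measurable _).indicator hs), Measure.dirac_apply' _ hs,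
      ← mul_assoc, ← ENNReal.ofReal_mul (by positivity)]
    by_cases hn : x n ∈ s
    · simp only [hn, indicator_of_mem, Pi.one_apply, mul_one]
      rw [← ENNReal.ofReal_mul (by positivity)]
      congr 1
      rw [weight]
      field_simp
    · simp [hn]
  have := isProbabilityMeasure_weighted c hN x
  rw [bayesUpdate, h, normalized_smul (ENNReal.ofReal_pos.2 (by positivity)).ne'
    ENNReal.ofReal_ne_top, normalized_eq_self]

lemma measurable_weight (c : ℝ) {N : ℕ} (n : Fin N) :
    Measurable fun x : Fin N → ℝ => weight c x n := by
  unfold weight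
  fun_prop

lemma measurable_cdf_weighted (c : ℝ) {N : ℕ} (hN : 0 < N) (a : ℝ) :
    Measurable fun x : Fin N → ℝ => cdf (weighted c x) a := by
  have h : ∀ x : Fin N → ℝ, cdf (weighted c x) a =
      ∑ n, weight c x n * (Iic a).indicator (fun _ => (1 : ℝ)) (x n) := fun x => by
    have := isProbabilityMeasure_weighted c hN x
    rw [cdf_eq_real]
    exact measureReal_sum_smul_dirac (weight_nonneg c x) x measurableSet_Iic
  simp_rw [h]
  refine Finset.measurable_fun_sum _ fun n _ => (measurable_weight c n).mul ?_
  exact (measurable_const.indicator measurableSet_Iic).comp (measurable_pi_apply n)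

lemma empirical_real {N : ℕ} (x : Fin N → ℝ) {s : Set ℝ} (hs : MeasurableSet s) :
    (empirical x).real s = (∑ n, s.indicator (fun _ => (1 : ℝ)) (x n)) / N := by
  rw [empirical, measureReal_sum_smul_dirac (fun _ => by positivity) x hs, ← Finset.mul_sum]
  ring

lemma measurable_cdf_empirical {N : ℕ} (hN : 0 < N) (a : ℝ) :
    Measurable fun x : Fin N → ℝ => cdf (empirical x) a := by
  have h : ∀ x : Fin N → ℝ, cdf (empirical x) a =
      (∑ n, (Iic a).indicator (fun _ => (1 : ℝ)) (x n)) / N := fun x => by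
    have := isProbabilityMeasure_empirical hN x
    rw [cdf_eq_real, empirical_real x measurableSet_Iic]
  simp_rw [h]
  refine (Finset.measurable_fun_sum _ fun n _ => ?_).div_const _
  exact (measurable_const.indicator measurableSet_Iic).comp (measurable_pi_apply n)

lemma measurable_cdf_transition (ρ σ a : ℝ) : Measurable fun z => cdf (transition ρ σ z) a :=
  measurable_cdf_gaussianReal ρ _ a

lemma predictStep_empirical (ρ σ c : ℝ) {N : ℕ} (hN : 0 < N) (x : Fin N → ℝ) :
    predictStep ρ σ c (empirical x) = (weighted c x).bind (transition ρ σ) := by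
  rw [predictStep, weighted_eq_bayesUpdate c hN]

lemma measurable_cdf_predictStep_empirical (ρ σ : ℝ) {c : ℝ} (hc : 0 ≤ c) {N : ℕ} (hN : 0 < N)
    (a : ℝ) : Measurable fun x : Fin N → ℝ => cdf (predictStep ρ σ c (empirical x)) a := by
  have h : ∀ x : Fin N → ℝ, cdf (predictStep ρ σ c (empirical x)) a =
      ∑ n, weight c x n * cdf (transition ρ σ (x n)) a := fun x => by
    have := isProbabilityMeasure_empirical hN x
    have := isProbabilityMeasure_predictStep ρ σ hc (empirical x)
    rw [cdf_eq_real, measureReal_def, predictStep_empirical ρ σ c hN,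
      Measure.bind_apply measurableSet_Iic (Kernel.aemeasurable _), weighted,
      lintegral_finsetSum_measure, ENNReal.toReal_sum]
    · refine Finset.sum_congr rfl fun n _ => ?_
      rw [lintegral_smul_measure, lintegral_dirac, smul_eq_mul, ENNReal.toReal_mul,
        ENNReal.toReal_ofReal (weight_nonneg c x n), cdf_eq_real, measureReal_def]
    · intro n _
      rw [lintegral_smul_measure, lintegral_dirac, smul_eq_mul]
      exact ENNReal.mul_ne_top ENNReal.ofReal_ne_top (measure_ne_top _ _)
  simp_rw [h]
  exact Finset.measurable_fun_sum _ fun n _ => (measurable_weight c n).mul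
    ((measurable_cdf_transition ρ σ a).comp (measurable_pi_apply n))

/-! ### Concentration of empirical distribution functions -/

section Concentration

variable {Ω : Type*} [MeasurableSpace Ω] {P : Measure Ω} [IsProbabilityMeasure P]

/-- Hoeffding's inequality for indicators, which are sub-Gaussian with parameter 1/4 after centring.
-/
lemma measure_empirical_ge_le {N : ℕ} (hN : 0 < N) {X : Fin N → Ω → ℝ} {ν : Measure ℝ}
    [IsProbabilityMeasure ν] (hX : ∀ n, Measurable (X n)) (hlaw : ∀ n, P.map (X n) = ν)
    (hind : iIndepFun X P) {s : Set ℝ} (hs : MeasurableSet s) {ε : ℝ} (hε : 0 ≤ ε) :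
    P {ω | ν.real s + ε ≤ (empirical fun n => X n ω).real s} ≤
      ENNReal.ofReal (Real.exp (-(2 * N * ε ^ 2))) := by
  have hN' : (0 : ℝ) < N := Nat.cast_pos.2 hN
  have hI : Measurable (s.indicator fun _ : ℝ => (1 : ℝ)) := measurable_const.indicator hs
  have hmean : ∀ n, P[fun ω => s.indicator (fun _ => (1 : ℝ)) (X n ω)] = ν.real s := by
    intro n
    rw [← integral_map (hX n).aemeasurable hI.aestronglyMeasurable, hlaw n,
      integral_indicator_const _ hs, smul_eq_mul, mul_one]
  have hsub : ∀ n, HasSubgaussianMGF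
      (fun ω => s.indicator (fun _ => (1 : ℝ)) (X n ω) - ν.real s) ((‖(1 : ℝ) - 0‖₊ / 2) ^ 2) P := by
    intro n
    have := hasSubgaussianMGF_of_mem_Icc (μ := P) (a := 0) (b := 1)
      (X := fun ω => s.indicator (fun _ => (1 : ℝ)) (X n ω)) (hI.comp (hX n)).aemeasurable
      (Eventually.of_forall fun ω => by
        by_cases h : X n ω ∈ s <;> simp [h])
    rwa [hmean n] at this
  have hind' : iIndepFun (fun n ω => s.indicator (fun _ => (1 : ℝ)) (X n ω) - ν.real s) P :=
    hind.comp (fun _ y => s.indicator (fun _ => (1 : ℝ)) y - ν.real s) fun _ => hI.sub_const _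
  have h := HasSubgaussianMGF.measure_sum_ge_le_of_iIndepFun hind' (s := Finset.univ)
    (fun n _ => hsub n) (ε := N * ε) (by positivity)
  have hset : {ω | ν.real s + ε ≤ (empirical fun n => X n ω).real s} =
      {ω | N * ε ≤ ∑ n, (s.indicator (fun _ => (1 : ℝ)) (X n ω) - ν.real s)} := by
    ext ω
    simp only [mem_ofPred_eq, empirical_real _ hs, Finset.sum_sub_distrib, Finset.sum_const,
      Finset.card_univ, Fintype.card_fin, nsmul_eq_mul]
    rw [le_div_iff₀ hN']
    constructor <;> intro h <;> linarith
  rw [hset, ← ofReal_measureReal]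
  refine ENNReal.ofReal_le_ofReal (h.trans_eq ?_)
  congr 1
  simp
  field_simp

lemma real_Iio_quantile_le (ν : Measure ℝ) [IsProbabilityMeasure ν] {u : ℝ}
    (hu : u ∈ Ioo (0 : ℝ) 1) : ν.real (Iio (quantile ν u)) ≤ u := by
  have h1 : ν (Iio (quantile ν u)) = ENNReal.ofReal (Function.leftLim (cdf ν) (quantile ν u) - 0) := by
    rw [← StieltjesFunction.measure_Iio _ (tendsto_cdf_atBot ν), measure_cdf]
  have h2 : Function.leftLim (cdf ν) (quantile ν u) ≤ u := by
    refine le_of_tendsto ((monotone_cdf ν).tendsto_leftLim _) ?_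
    filter_upwards [self_mem_nhdsWithin] with y hy
    by_contra! h
    exact absurd ((quantile_le_iff ν hu y).2 h.le) (not_le.2 hy)
  rw [measureReal_def, h1, sub_zero]
  exact ENNReal.toReal_le_of_le_ofReal hu.1.le (ENNReal.ofReal_le_ofReal h2)

/-- Monotonicity reduces the supremum to the quantiles of levels i/J, at a loss of 1/J ≤ ε/2. Atoms
force closed half-lines for the lower bound and open ones for the upper bound. -/
lemma abs_cdf_sub_le_of_grid {μ ν : Measure ℝ} [IsProbabilityMeasure μ] [IsProbabilityMeasure ν]
    {ε : ℝ} {J : ℕ} (hε : 0 < ε) (hJ : 2 / ε ≤ J)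
    (h1 : ∀ i < J, ν.real (Iic (quantile ν (i / J))) - ε / 2 ≤ μ.real (Iic (quantile ν (i / J))))
    (h2 : ∀ i < J, μ.real (Iio (quantile ν (i / J))) ≤ ν.real (Iio (quantile ν (i / J))) + ε / 2)
    (a : ℝ) : |cdf μ a - cdf ν a| ≤ ε := by
  have hJ0 : (0 : ℝ) < J := lt_of_lt_of_le (by positivity) hJ
  have hJε : 1 / (J : ℝ) ≤ ε / 2 := by
    rw [div_le_div_iff₀ hJ0 two_pos, one_mul]
    rw [div_le_iff₀ hε] at hJ
    linarith
  set F := cdf ν a with hF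
  have hF0 : 0 ≤ F := cdf_nonneg _ _
  have hF1 : F ≤ 1 := cdf_le_one _ _
  rw [abs_le]
  constructor
  -- For F > 0 this is the last level strictly below F. If it is 0, including by truncated
  -- subtraction, then F ≤ 1/J and there is nothing to prove.
  · obtain ⟨i, hi⟩ : ∃ i : ℕ, i = ⌈J * F⌉₊ - 1 := ⟨_, rfl⟩
    rcases Nat.eq_zero_or_pos i with h0 | hpos
    · have h3 : ⌈J * F⌉₊ ≤ 1 := by omega
      have h4 : J * F ≤ 1 := by
        have := Nat.le_of_ceil_le h3
        exact_mod_cast this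
      have h5 : F ≤ 1 / J := by rw [le_div_iff₀ hJ0]; linarith
      linarith [cdf_nonneg μ a]
    · have hi1 : i + 1 = ⌈J * F⌉₊ := by omega
      have h3 : (i : ℝ) < J * F := Nat.lt_ceil.1 (by omega)
      have h4 : J * F ≤ i + 1 := by
        have := Nat.le_ceil (J * F)
        rw [← hi1] at this
        exact_mod_cast this
      have h5 : (i : ℝ) < J := h3.trans_le (mul_le_of_le_one_right hJ0.le hF1)
      have hu : (i / J : ℝ) ∈ Ioo (0 : ℝ) 1 :=
        ⟨div_pos (Nat.cast_pos.2 hpos) hJ0, (div_lt_one hJ0).2 h5⟩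
      have h6 : quantile ν (i / J) ≤ a := by
        rw [quantile_le_iff ν hu, div_le_iff₀ hJ0, mul_comm]
        exact h3.le
      have h7 := h1 i (by exact_mod_cast h5)
      rw [← cdf_eq_real, ← cdf_eq_real] at h7
      have h8 := le_cdf_quantile ν hu
      have h9 := monotone_cdf μ h6
      have h10 : F ≤ i / J + 1 / J := by
        rw [← add_div, le_div_iff₀ hJ0]
        linarith
      linarith
  -- The first level strictly above F; if it is not below 1, then F ≥ 1 - 1/J.
  · set i : ℕ := ⌊J * F⌋₊ + 1 with hi
    have h3 : J * F < i := by
      have := Nat.lt_floor_add_one (J * F)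
      rw [hi]
      exact_mod_cast this
    have h4 : (i : ℝ) ≤ J * F + 1 := by
      have := Nat.floor_le (by positivity : 0 ≤ J * F)
      rw [hi]
      push_cast
      linarith
    have h5 : (i / J : ℝ) ≤ F + 1 / J := by
      rw [div_le_iff₀ hJ0, add_mul, div_mul_cancel₀ _ hJ0.ne']
      linarith
    by_cases hlt : i < J
    · have hlt' : (i : ℝ) < J := by exact_mod_cast hlt
      have hu : (i / J : ℝ) ∈ Ioo (0 : ℝ) 1 :=
        ⟨div_pos (by rw [hi]; positivity) hJ0, (div_lt_one hJ0).2 hlt'⟩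
      have h6 : a < quantile ν (i / J) := by
        by_contra! h
        rw [quantile_le_iff ν hu, div_le_iff₀ hJ0, mul_comm] at h
        linarith
      have h7 := h2 i hlt
      have h8 := real_Iio_quantile_le ν hu
      have h9 : cdf μ a ≤ μ.real (Iio (quantile ν (i / J))) := by
        rw [cdf_eq_real]
        exact measureReal_mono fun y hy => lt_of_le_of_lt hy h6
      linarith
    · have hge : (J : ℝ) ≤ i := by exact_mod_cast not_lt.1 hlt
      have : 1 ≤ (i / J : ℝ) := by rwa [le_div_iff₀ hJ0, one_mul]
      linarith [cdf_le_one μ a]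

/-- A Dvoretzky–Kiefer–Wolfowitz type inequality, with a non-optimal prefactor. -/
lemma measure_exists_lt_abs_cdf_empirical_sub_le {N : ℕ} (hN : 0 < N) {X : Fin N → Ω → ℝ}
    {ν : Measure ℝ} [IsProbabilityMeasure ν] (hX : ∀ n, Measurable (X n))
    (hlaw : ∀ n, P.map (X n) = ν) (hind : iIndepFun X P) {ε : ℝ} (hε : 0 < ε) {J : ℕ}
    (hJ : 2 / ε ≤ J) :
    P {ω | ∃ a, ε < |cdf (empirical fun n => X n ω) a - cdf ν a|} ≤
      ENNReal.ofReal (2 * J * Real.exp (-(N * ε ^ 2 / 2))) := by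
  -- Complements turn lower deviations into upper ones, so the one-sided bound suffices. At i = 0
  -- the quantile is only a default value, which is harmless: the bound holds at any point.
  set A : ℕ → Set Ω := fun i => {ω | ν.real (Iic (quantile ν (i / J)))ᶜ + ε / 2 ≤
    (empirical fun n => X n ω).real (Iic (quantile ν (i / J)))ᶜ} with hA
  set B : ℕ → Set Ω := fun i => {ω | ν.real (Iio (quantile ν (i / J))) + ε / 2 ≤
    (empirical fun n => X n ω).real (Iio (quantile ν (i / J)))} with hB
  have hsub : {ω | ∃ a, ε < |cdf (empirical fun n => X n ω) a - cdf ν a|} ⊆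
      ⋃ i ∈ Finset.range J, (A i ∪ B i) := by
    rintro ω ⟨a, ha⟩
    by_contra hω
    simp only [mem_iUnion, Finset.mem_range, exists_prop, not_exists, not_and, mem_union,
      not_or] at hω
    have := isProbabilityMeasure_empirical hN fun n => X n ω
    refine absurd (abs_cdf_sub_le_of_grid (μ := empirical fun n => X n ω) (ν := ν) hε hJ
      (fun i hi => ?_) (fun i hi => ?_) a) (not_le.2 ha)
    · have h := (hω i hi).1
      simp only [hA, mem_ofPred_eq, not_le, probReal_compl_eq_one_sub measurableSet_Iic] at h
      linarith
    · have h := (hω i hi).2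
      simp only [hB, mem_ofPred_eq, not_le] at h
      exact h.le
  have hexp : Real.exp (-(2 * N * (ε / 2) ^ 2)) = Real.exp (-(N * ε ^ 2 / 2)) := by
    congr 1
    ring
  have hAB : ∀ i, P (A i ∪ B i) ≤ ENNReal.ofReal (2 * Real.exp (-(N * ε ^ 2 / 2))) := by
    intro i
    refine (measure_union_le _ _).trans ?_
    rw [two_mul, ENNReal.ofReal_add (by positivity) (by positivity), ← hexp]
    exact add_le_add
      (measure_empirical_ge_le hN hX hlaw hind measurableSet_Iic.compl (by positivity))
      (measure_empirical_ge_le hN hX hlaw hind measurableSet_Iio (by positivity))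
  refine (measure_mono hsub).trans ((measure_biUnion_finset_le _ _).trans
    ((Finset.sum_le_sum fun i _ => hAB i).trans_eq ?_))
  rw [Finset.sum_const, Finset.card_range, nsmul_eq_mul, ← ENNReal.ofReal_natCast J,
    ← ENNReal.ofReal_mul (by positivity)]
  congr 1
  ring

end Concentration

/-! ### The random points and the particles -/

/-- Points outside the open unit square are replaced by its centre. -/
noncomputable def clamp (p : ℝ × ℝ) : ℝ × ℝ :=
  open Classical in if p ∈ Ioo (0 : ℝ) 1 ×ˢ Ioo (0 : ℝ) 1 then p else (1 / 2, 1 / 2)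

lemma clamp_of_mem {p : ℝ × ℝ} (h : p ∈ Ioo (0 : ℝ) 1 ×ˢ Ioo (0 : ℝ) 1) : clamp p = p := if_pos h

lemma clamp_mem (p : ℝ × ℝ) : clamp p ∈ Ioo (0 : ℝ) 1 ×ˢ Ioo (0 : ℝ) 1 := by
  unfold clamp
  split_ifs with h
  · exact h
  · constructor <;> norm_num

@[fun_prop]
lemma measurable_clamp : Measurable clamp := by
  classical
  exact Measurable.ite (measurableSet_Ioo.prod measurableSet_Ioo) measurable_id measurable_const

/-- One step of the particle filter: resampling followed by mutation. -/
noncomputable def particleStep (ρ σ : ℝ) (π : Measure ℝ) (p : ℝ × ℝ) : ℝ :=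
  quantile (transition ρ σ (quantile π p.1)) p.2

lemma measurable_particleStep (ρ σ : ℝ) {α : Type*} [MeasurableSpace α] {Z : α → Measure ℝ}
    (hZ : ∀ a, Measurable fun z => cdf (Z z) a) {w : α → ℝ × ℝ} (hw : Measurable w) :
    Measurable fun z => particleStep ρ σ (Z z) (clamp (w z)) := by
  refine measurable_quantile (fun a => (measurable_cdf_transition ρ σ a).comp ?_)
    (by fun_prop) fun z => (clamp_mem (w z)).2
  exact measurable_quantile hZ (by fun_prop) fun z => (clamp_mem (w z)).1

/-- Clamping the points gives measurability everywhere, not only almost everywhere; almost surely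
the particles are unchanged. -/
lemma measurable_particles (ρ σ c : ℝ) (η : Measure ℝ) {N : ℕ} (hN : 0 < N) {α : Type*}
    [MeasurableSpace α] {u : α → ℕ → Fin N → ℝ × ℝ} (hu : ∀ j n, Measurable fun z => u z j n)
    (k : ℕ) : Measurable fun z => particles ρ σ c η (fun j n => clamp (u z j n)) k := by
  induction k with
  | zero =>
    refine measurable_pi_lambda _ fun n => ?_
    have := hu 0 n
    exact measurable_quantile (fun a => measurable_const) (by fun_prop)
      fun z => (clamp_mem (u z 0 n)).1
  | succ k ih =>
    refine measurable_pi_lambda _ fun n => ?_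
    exact measurable_particleStep ρ σ (fun a => (measurable_cdf_weighted c hN a).comp ih)
      (hu (k + 1) n)

lemma particles_congr (ρ σ c : ℝ) (η : Measure ℝ) {N : ℕ} {u u' : ℕ → Fin N → ℝ × ℝ} {k : ℕ}
    (h : ∀ j ≤ k, u j = u' j) : particles ρ σ c η u k = particles ρ σ c η u' k := by
  induction k with
  | zero =>
    ext n
    simp only [particles, h 0 le_rfl]
  | succ k ih =>
    ext n
    simp only [particles, h (k + 1) le_rfl, ih fun j hj => h j (hj.trans k.le_succ)]

lemma restrict_Ioo_prod :
    (volume : Measure (ℝ × ℝ)).restrict (Ioo (0 : ℝ) 1 ×ˢ Ioo (0 : ℝ) 1) =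
      (volume.restrict (Ioo (0 : ℝ) 1)).prod (volume.restrict (Ioo (0 : ℝ) 1)) := by
  rw [Measure.prod_restrict]
  rfl

/-- Inverse transform sampling twice, by Fubini: the first coordinate draws from π, and the second
then draws from the transition started at that point. -/
lemma map_particleStep (ρ σ : ℝ) (π : Measure ℝ) [IsProbabilityMeasure π] :
    ((volume : Measure (ℝ × ℝ)).restrict (Ioo (0 : ℝ) 1 ×ˢ Ioo (0 : ℝ) 1)).map
      (fun p => particleStep ρ σ π (clamp p)) = π.bind (transition ρ σ) := by
  have hlam : IsProbabilityMeasure (volume.restrict (Ioo (0 : ℝ) 1)) := ⟨by simp⟩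
  have hm : Measurable fun p => particleStep ρ σ π (clamp p) :=
    measurable_particleStep ρ σ (fun a => measurable_const) measurable_id
  rw [restrict_Ioo_prod]
  have : IsProbabilityMeasure (((volume.restrict (Ioo (0 : ℝ) 1)).prod
      (volume.restrict (Ioo (0 : ℝ) 1))).map fun p => particleStep ρ σ π (clamp p)) :=
    Measure.isProbabilityMeasure_map hm.aemeasurable
  refine Measure.ext_of_Iic _ _ fun a => ?_
  have haeq : AEMeasurable (quantile π) (volume.restrict (Ioo (0 : ℝ) 1)) := by
    -- A pushforward along a function that is not a.e. measurable is 0 by convention, whereas this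
    -- one is π.
    refine AEMeasurable.of_map_ne_zero ?_
    rw [map_quantile_uniform]
    exact IsProbabilityMeasure.ne_zero π
  rw [Measure.map_apply hm measurableSet_Iic, Measure.prod_apply (hm measurableSet_Iic),
    Measure.bind_apply measurableSet_Iic (Kernel.aemeasurable _)]
  conv_rhs => rw [← map_quantile_uniform π]
  rw [lintegral_map' ((transition ρ σ).measurable_coe measurableSet_Iic).aemeasurable haeq]
  refine lintegral_congr_ae ?_
  filter_upwards [ae_restrict_mem measurableSet_Ioo] with u hu
  have haeq' : AEMeasurable (quantile (transition ρ σ (quantile π u)))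
      (volume.restrict (Ioo (0 : ℝ) 1)) := by
    refine AEMeasurable.of_map_ne_zero ?_
    rw [map_quantile_uniform]
    exact IsProbabilityMeasure.ne_zero _
  conv_rhs => rw [← map_quantile_uniform (transition ρ σ (quantile π u)),
    Measure.map_apply_of_aemeasurable haeq' measurableSet_Iic]
  refine measure_congr ?_
  filter_upwards [ae_restrict_mem measurableSet_Ioo] with w hw
  refine propext ?_
  change particleStep ρ σ π (clamp (u, w)) ≤ a ↔ quantile (transition ρ σ (quantile π u)) w ≤ a
  rw [clamp_of_mem ⟨hu, hw⟩]
  rfl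

section Sampling

variable {Ω : Type*} [MeasurableSpace Ω] {P : Measure Ω} {N : ℕ}
  {U : ℕ → Fin N → Ω → ℝ × ℝ}

lemma IsUniformIID.map_eq (hU : IsUniformIID P U) (k : ℕ) (n : Fin N) :
    P.map (U k n) = (volume : Measure (ℝ × ℝ)).restrict (Ioo (0 : ℝ) 1 ×ˢ Ioo (0 : ℝ) 1) := by
  have h : P.map (U k n) = cond volume (Ioo (0 : ℝ) 1 ×ˢ Ioo (0 : ℝ) 1) := hU.uniform k n
  have h1 : (volume : Measure (ℝ × ℝ)) (Ioo (0 : ℝ) 1 ×ˢ Ioo (0 : ℝ) 1) = 1 := by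
    rw [Measure.volume_eq_prod, Measure.prod_prod]
    simp
  rw [h, ProbabilityTheory.cond, h1, inv_one, one_smul]

lemma IsUniformIID.ae_mem (hU : IsUniformIID P U) :
    ∀ᵐ ω ∂P, ∀ k n, U k n ω ∈ Ioo (0 : ℝ) 1 ×ˢ Ioo (0 : ℝ) 1 := by
  refine ae_all_iff.2 fun k => ae_all_iff.2 fun n => ?_
  refine ae_of_ae_map (hU.measurable k n).aemeasurable ?_
  rw [hU.map_eq]
  exact ae_restrict_mem (measurableSet_Ioo.prod measurableSet_Ioo)

lemma IsUniformIID.iIndepFun_time (hU : IsUniformIID P U) (k : ℕ) : iIndepFun (U k) P :=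
  hU.indep.precomp (g := fun n : Fin N => (k, n)) fun _ _ h => congrArg Prod.snd h

lemma IsUniformIID.map_particleStep (hU : IsUniformIID P U) (ρ σ : ℝ) (π : Measure ℝ)
    [IsProbabilityMeasure π] (k : ℕ) (n : Fin N) :
    P.map (fun ω => particleStep ρ σ π (clamp (U k n ω))) = π.bind (transition ρ σ) := by
  have hm : Measurable fun p => particleStep ρ σ π (clamp p) :=
    measurable_particleStep ρ σ (fun a => measurable_const) measurable_id
  rw [← ParticleFilter.map_particleStep ρ σ π, ← hU.map_eq k n, Measure.map_map hm
    (hU.measurable k n)]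
  rfl

lemma IsUniformIID.measure_initial_le [IsProbabilityMeasure P] (hU : IsUniformIID P U)
    (hN : 0 < N) (η : Measure ℝ)
    [IsProbabilityMeasure η] (ρ σ c : ℝ) {ε : ℝ} (hε : 0 < ε) {J : ℕ} (hJ : 2 / ε ≤ J) :
    P {ω | ∃ a, ε < |cdf (predictEst ρ σ c η (fun j n => clamp (U j n ω)) 0) a - cdf η a|} ≤
      ENNReal.ofReal (2 * J * Real.exp (-(N * ε ^ 2 / 2))) := by
  have hm : Measurable fun p => quantile η (clamp p).1 :=
    measurable_quantile (fun a => measurable_const) (by fun_prop) fun p => (clamp_mem p).1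
  refine measure_exists_lt_abs_cdf_empirical_sub_le (P := P) hN
    (X := fun n ω => quantile η (clamp (U 0 n ω)).1) (ν := η)
    (fun n => hm.comp (hU.measurable 0 n)) (fun n => ?_)
    ((hU.iIndepFun_time 0).comp (fun _ p => quantile η (clamp p).1) fun _ => hm) hε hJ
  have h1 : P.map (fun ω => quantile η (clamp (U 0 n ω)).1) =
      (P.map (U 0 n)).map fun p => quantile η (clamp p).1 := by
    rw [Measure.map_map hm (hU.measurable 0 n)]
    rfl
  have hlam : IsProbabilityMeasure (volume.restrict (Ioo (0 : ℝ) 1)) := ⟨by simp⟩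
  have haeq : AEMeasurable (quantile η) (volume.restrict (Ioo (0 : ℝ) 1)) := by
    refine AEMeasurable.of_map_ne_zero ?_
    rw [map_quantile_uniform]
    exact IsProbabilityMeasure.ne_zero η
  have h2 : (fun p : ℝ × ℝ => quantile η (clamp p).1) =ᵐ[(volume : Measure (ℝ × ℝ)).restrict
      (Ioo (0 : ℝ) 1 ×ˢ Ioo (0 : ℝ) 1)] quantile η ∘ Prod.fst := by
    filter_upwards [ae_restrict_mem (measurableSet_Ioo.prod measurableSet_Ioo)] with p hp
    rw [clamp_of_mem hp]
    rfl
  have h3 : ((volume.restrict (Ioo (0 : ℝ) 1)).prod (volume.restrict (Ioo (0 : ℝ) 1))).map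
      Prod.fst = volume.restrict (Ioo (0 : ℝ) 1) := by
    rw [Measure.map_fst_prod, measure_univ, one_smul]
  rw [h1, hU.map_eq, Measure.map_congr h2, restrict_Ioo_prod,
    ← AEMeasurable.map_map_of_aemeasurable (by rw [h3]; exact haeq) measurable_fst.aemeasurable,
    h3, map_quantile_uniform]

/-- Right-continuity of both distribution functions makes the strict inequality persist just to the
right of a. This reduces the event to a countable union, hence its measurability. -/
lemma exists_rat_lt_abs_cdf_sub {μ ν : Measure ℝ} {ε : ℝ} (h : ∃ a, ε < |cdf μ a - cdf ν a|) :
    ∃ a : ℚ, ε < |cdf μ a - cdf ν a| := by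
  obtain ⟨a, ha⟩ := h
  have hc : ∀ π : Measure ℝ, Tendsto (cdf π) (𝓝[>] a) (𝓝 (cdf π a)) := fun π =>
    ((cdf π).right_continuous a).tendsto.mono_left (nhdsWithin_mono _ Ioi_subset_Ici_self)
  have hev := ((hc μ).sub (hc ν)).abs.eventually_const_lt ha
  obtain ⟨b, hab, hb⟩ := mem_nhdsGT_iff_exists_Ioo_subset.1 hev
  obtain ⟨r, h1, h2⟩ := exists_rat_btwn (mem_Ioi.1 hab)
  exact ⟨r, hb ⟨h1, h2⟩⟩

lemma measurableSet_exists_lt_abs_cdf_sub {α : Type*} [MeasurableSpace α] {Y Z : α → Measure ℝ}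
    (hY : ∀ a, Measurable fun z => cdf (Y z) a) (hZ : ∀ a, Measurable fun z => cdf (Z z) a)
    (ε : ℝ) : MeasurableSet {z | ∃ a, ε < |cdf (Y z) a - cdf (Z z) a|} := by
  have : {z | ∃ a, ε < |cdf (Y z) a - cdf (Z z) a|} =
      ⋃ a : ℚ, {z | ε < |cdf (Y z) a - cdf (Z z) a|} := by
    ext z
    simp only [mem_iUnion]
    exact ⟨exists_rat_lt_abs_cdf_sub, fun ⟨a, ha⟩ => ⟨a, ha⟩⟩
  rw [this]
  refine MeasurableSet.iUnion fun a => measurableSet_lt measurable_const ?_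
  exact measurable_abs.comp ((hY a).sub (hZ a))

lemma IsUniformIID.indepFun_particles (hU : IsUniformIID P U) (hN : 0 < N) (η : Measure ℝ)
    (ρ σ c : ℝ) (k : ℕ) :
    IndepFun (fun ω => particles ρ σ c η (fun j n => clamp (U j n ω)) k)
      (fun ω n => U (k + 1) n ω) P := by
  classical
  set S : Finset (ℕ × Fin N) := Finset.range (k + 1) ×ˢ Finset.univ with hS
  set T : Finset (ℕ × Fin N) := {k + 1} ×ˢ Finset.univ with hT
  have hST : Disjoint S T := by
    rw [Finset.disjoint_left]
    rintro ⟨j, n⟩ hj hj'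
    simp only [hS, hT, Finset.mem_product, Finset.mem_range, Finset.mem_singleton] at hj hj'
    omega
  have hind := hU.indep.indepFun_finset S T hST fun p => hU.measurable p.1 p.2
  have hTmem : ∀ n, (k + 1, n) ∈ T := fun n => by simp [hT]
  -- Past points are extended by 0 to all times; the particles at time k never read the extension.
  set E : (S → ℝ × ℝ) → ℕ → Fin N → ℝ × ℝ := fun z j n =>
    if h : (j, n) ∈ S then z ⟨(j, n), h⟩ else 0 with hE
  have hEm : ∀ j n, Measurable fun z => E z j n := by
    intro j n
    by_cases h : (j, n) ∈ S
    · simp only [hE, h, dite_true]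
      exact measurable_pi_apply _
    · simp only [hE, h, dite_false]
      exact measurable_const
  have hcomp := hind.comp (measurable_particles ρ σ c η hN hEm k)
    (measurable_pi_lambda (fun (z : T → ℝ × ℝ) n => z ⟨(k + 1, n), hTmem n⟩)
      fun n => measurable_pi_apply _)
  refine hcomp.congr (Eventually.of_forall fun ω => ?_) (Eventually.of_forall fun ω => rfl)
  symm
  refine particles_congr ρ σ c η fun j hj => ?_
  ext1 n
  have h : (j, n) ∈ S := by simp [hS]; omega
  simp only [hE, h, dite_true]

/-- Condition on the current particles. They are independent of the new points, so the joint law is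
a product, and for each frozen x the new particles are i.i.d. from Φ of the empirical measure of x.
The resulting bound does not depend on x. -/
lemma IsUniformIID.measure_step_le [IsProbabilityMeasure P] (hU : IsUniformIID P U)
    (hN : 0 < N) (η : Measure ℝ)
    (ρ σ : ℝ) {c : ℝ} (hc : 0 ≤ c) {ε : ℝ} (hε : 0 < ε) {J : ℕ} (hJ : 2 / ε ≤ J) (k : ℕ) :
    P {ω | ∃ a, ε < |cdf (predictEst ρ σ c η (fun j n => clamp (U j n ω)) (k + 1)) a -
        cdf (predictStep ρ σ c (predictEst ρ σ c η (fun j n => clamp (U j n ω)) k)) a|} ≤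
      ENNReal.ofReal (2 * J * Real.exp (-(N * ε ^ 2 / 2))) := by
  set X : Ω → Fin N → ℝ := fun ω => particles ρ σ c η (fun j n => clamp (U j n ω)) k with hX
  set V : Ω → Fin N → ℝ × ℝ := fun ω n => U (k + 1) n ω with hV
  have hXm : Measurable X := measurable_particles ρ σ c η hN (fun j n => hU.measurable j n) k
  have hVm : Measurable V := measurable_pi_lambda _ fun n => hU.measurable (k + 1) n
  set A : Set ((Fin N → ℝ) × (Fin N → ℝ × ℝ)) := {p | ∃ a, ε <
    |cdf (empirical fun n => particleStep ρ σ (weighted c p.1) (clamp (p.2 n))) a -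
      cdf (predictStep ρ σ c (empirical p.1)) a|} with hA
  have hAm : MeasurableSet A := by
    refine measurableSet_exists_lt_abs_cdf_sub (fun a => ?_) (fun a => ?_) ε
    · refine (measurable_cdf_empirical hN a).comp (measurable_pi_lambda _ fun n => ?_)
      exact measurable_particleStep ρ σ
        (fun a => (measurable_cdf_weighted c hN a).comp measurable_fst) (by fun_prop)
    · exact (measurable_cdf_predictStep_empirical ρ σ hc hN a).comp measurable_fst
  have hset : {ω | ∃ a, ε < |cdf (predictEst ρ σ c η (fun j n => clamp (U j n ω)) (k + 1)) a -
      cdf (predictStep ρ σ c (predictEst ρ σ c η (fun j n => clamp (U j n ω)) k)) a|} =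
      (fun ω => (X ω, V ω)) ⁻¹' A := rfl
  have hind : IndepFun X V P := hU.indepFun_particles hN η ρ σ c k
  have := Measure.isProbabilityMeasure_map (μ := P) hXm.aemeasurable
  have := Measure.isProbabilityMeasure_map (μ := P) hVm.aemeasurable
  rw [hset, ← Measure.map_apply (hXm.prodMk hVm) hAm,
    (indepFun_iff_map_prod_eq_prod_map_map hXm.aemeasurable hVm.aemeasurable).1 hind,
    Measure.prod_apply hAm]
  suffices h : ∀ x, P.map V (Prod.mk x ⁻¹' A) ≤
      ENNReal.ofReal (2 * J * Real.exp (-(N * ε ^ 2 / 2))) by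
    refine (lintegral_mono h).trans_eq ?_
    rw [lintegral_const, measure_univ, mul_one]
  intro x
  rw [Measure.map_apply hVm (measurable_prodMk_left hAm)]
  have := isProbabilityMeasure_empirical hN x
  have := isProbabilityMeasure_weighted c hN x
  have hp := isProbabilityMeasure_predictStep ρ σ hc (empirical x)
  have hm : Measurable fun p => particleStep ρ σ (weighted c x) (clamp p) :=
    measurable_particleStep ρ σ (fun a => measurable_const) measurable_id
  refine measure_exists_lt_abs_cdf_empirical_sub_le (P := P) hN
    (X := fun n ω => particleStep ρ σ (weighted c x) (clamp (U (k + 1) n ω)))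
    (ν := predictStep ρ σ c (empirical x))
    (fun n => hm.comp (hU.measurable (k + 1) n)) (fun n => ?_)
    ((hU.iIndepFun_time (k + 1)).comp (fun _ p => particleStep ρ σ (weighted c x) (clamp p))
      fun _ => hm) hε hJ
  rw [hU.map_particleStep, predictStep_empirical ρ σ c hN]

end Sampling

/-! ### ### Choice of the sample size and conclusion -/

/-- With 2J ≤ 6/ε it suffices that N ε²/2 dominates log (6/e) + log (1/κ) + log (T/q). A product of
factors at least 1 absorbs this sum, and one power of the logarithm in κ would do. -/
lemma mul_exp_le_of_le_log {ε κ q : ℝ} {T N J : ℕ} {e : ℝ} (he : 0 < e) (he1 : e ≤ 1)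
    (hκ : 0 < κ) (hκ1 : κ < 1) (hq : 0 < q) (hq1 : q < 1) (hT : 1 ≤ T) (hε : ε = e * κ)
    (hJ : (J : ℝ) ≤ 2 / ε + 1)
    (hN : 2 / e ^ 2 * (Real.log (6 / e) + 1) * (1 + Real.log (1 + κ⁻¹)) ^ 2 * (κ ^ 2)⁻¹ *
      (1 + Real.log (T / q)) ≤ N) :
    T * (2 * J * Real.exp (-(N * ε ^ 2 / 2))) ≤ q := by
  have hε0 : 0 < ε := by rw [hε]; positivity
  have hε1 : ε ≤ 1 := by rw [hε]; nlinarith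
  have hT' : (1 : ℝ) ≤ T := by exact_mod_cast hT
  have hJ' : 2 * (J : ℝ) ≤ 6 / ε := by
    have h1 : 1 ≤ 1 / ε := by rwa [le_div_iff₀ hε0, one_mul]
    have h2 : 2 / ε = 2 * (1 / ε) := by ring
    have h3 : 6 / ε = 6 * (1 / ε) := by ring
    rw [h2] at hJ
    rw [h3]
    linarith
  set L := 1 + Real.log (1 + κ⁻¹) with hL
  set l := Real.log (T / q) with hl
  set m := Real.log (6 / e) with hm
  have hl0 : 0 ≤ l := Real.log_nonneg (by rw [le_div_iff₀ hq]; linarith)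
  have hm0 : 0 ≤ m := Real.log_nonneg (by rw [le_div_iff₀ he]; linarith)
  have hκi : 0 < κ⁻¹ := by positivity
  have hL1 : Real.log κ⁻¹ ≤ L - 1 := by
    rw [hL, add_sub_cancel_left]
    exact Real.log_le_log hκi (by linarith)
  have hL2 : 1 ≤ L := by
    have : 0 ≤ Real.log (1 + κ⁻¹) := Real.log_nonneg (by linarith)
    linarith
  have hNε : m + Real.log κ⁻¹ + l ≤ N * ε ^ 2 / 2 := by
    have h1 : (m + 1) * L ^ 2 * (1 + l) ≤ N * ε ^ 2 / 2 := by
      have h2 := mul_le_mul_of_nonneg_right hN (by positivity : 0 ≤ ε ^ 2 / 2)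
      refine le_trans (le_of_eq ?_) (h2.trans_eq (by ring))
      rw [hε]
      field_simp
    have h3 : L ≤ L ^ 2 := by nlinarith
    have h4 : (m + 1) * L * (1 + l) ≤ (m + 1) * L ^ 2 * (1 + l) := by gcongr
    have h5 : m + (L - 1) + l ≤ (m + 1) * L * (1 + l) := by
      nlinarith [mul_nonneg hm0 (sub_nonneg.2 hL2), mul_nonneg hl0 (sub_nonneg.2 hL2),
        mul_nonneg (mul_nonneg hm0 hl0) (by linarith : 0 ≤ L)]
    linarith
  have hexp : Real.exp (-(N * ε ^ 2 / 2)) ≤ (6 / ε * (T / q))⁻¹ := by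
    have h1 : 6 / ε * (T / q) = Real.exp (m + Real.log κ⁻¹ + l) := by
      rw [Real.exp_add, Real.exp_add, Real.exp_log (by positivity), Real.exp_log hκi,
        Real.exp_log (by positivity), hε]
      field_simp
    rw [h1, ← Real.exp_neg]
    exact Real.exp_le_exp.2 (neg_le_neg hNε)
  calc (T : ℝ) * (2 * J * Real.exp (-(N * ε ^ 2 / 2)))
      ≤ T * (6 / ε * (6 / ε * (T / q))⁻¹) := by gcongr
    _ = q := by field_simp

lemma kolmogorovDist_le {μ ν : Measure ℝ} {D : ℝ} (h : ∀ a, |cdf μ a - cdf ν a| ≤ D) :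
    kolmogorovDist μ ν ≤ D := ciSup_le h

end ParticleFilter

open ParticleFilter

theorem corollary1 (ρ σ c : ℝ) (hσ : 0 < σ) (hc : 0 < c)
    (η₁ : MeasureTheory.Measure ℝ) [MeasureTheory.IsProbabilityMeasure η₁] :
    ∃ C : ℝ, 0 < C ∧
      ∀ (Ω : Type*) [MeasurableSpace Ω] (P : MeasureTheory.Measure Ω)
        [MeasureTheory.IsProbabilityMeasure P]
        (κ q : ℝ), 0 < κ → κ < 1 → 0 < q → q < 1 →
      ∀ T : ℕ, 1 ≤ T →
      ∀ N : ℕ,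
        C * (1 + Real.log (1 + κ⁻¹)) ^ 2 * (κ ^ 2)⁻¹ * (1 + Real.log (T / q)) ≤ (N : ℝ) →
      ∀ U : ℕ → Fin N → Ω → ℝ × ℝ, ParticleFilter.IsUniformIID P U →
        ENNReal.ofReal (1 - q) ≤
          P {ω | ∀ k < T,
            ParticleFilter.kolmogorovDist
              (ParticleFilter.filterEst ρ σ c η₁ (fun j n => U j n ω) k)
              (ParticleFilter.filterDist ρ σ c η₁ k) ≤ κ ∧
            ParticleFilter.kolmogorovDist
              (ParticleFilter.predictEst ρ σ c η₁ (fun j n => U j n ω) k)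
              (ParticleFilter.predictDist ρ σ c η₁ k) ≤ κ} := by
  obtain ⟨C, ε₀, hC, hε₀, hprop⟩ := exists_uniform_error_bound ρ hσ hc η₁
  -- With ε = e κ, the bound e ≤ ε₀ makes the propagation lemma applicable and C e ≤ 1 brings the
  -- global error below κ.
  set e : ℝ := min 1 (min ε₀ C⁻¹) with he
  have he0 : 0 < e := lt_min one_pos (lt_min hε₀ (inv_pos.2 hC))
  have he1 : e ≤ 1 := min_le_left _ _
  have heε : e ≤ ε₀ := (min_le_right _ _).trans (min_le_left _ _)
  have heC : C * e ≤ 1 := by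
    have : e ≤ C⁻¹ := (min_le_right _ _).trans (min_le_right _ _)
    calc C * e ≤ C * C⁻¹ := by gcongr
      _ = 1 := mul_inv_cancel₀ hC.ne'
  have hm0 : 0 ≤ Real.log (6 / e) := Real.log_nonneg (by rw [le_div_iff₀ he0]; linarith)
  refine ⟨2 / e ^ 2 * (Real.log (6 / e) + 1), by positivity, ?_⟩
  intro Ω _ P _ κ q hκ hκ1 hq hq1 T hT N hN U hU
  have hT' : (1 : ℝ) ≤ T := by exact_mod_cast hT
  have hN0 : 0 < N := by
    have h1 : 0 ≤ Real.log (T / q) := Real.log_nonneg (by rw [le_div_iff₀ hq]; linarith)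
    have h2 : 0 ≤ Real.log (1 + κ⁻¹) := Real.log_nonneg (by
      have : 0 < κ⁻¹ := inv_pos.2 hκ
      linarith)
    have : (0 : ℝ) < N := lt_of_lt_of_le (by positivity) hN
    exact_mod_cast this
  set ε := e * κ with hε
  have hε0 : 0 < ε := mul_pos he0 hκ
  have hεε₀ : ε ≤ ε₀ := (mul_le_of_le_one_right he0.le hκ1.le).trans heε
  have hCε : C * ε ≤ κ := by
    rw [hε, ← mul_assoc]
    exact mul_le_of_le_one_left hκ.le heC
  set J := ⌈2 / ε⌉₊ with hJ
  have hJ1 : 2 / ε ≤ J := Nat.le_ceil _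
  have hJ2 : (J : ℝ) ≤ 2 / ε + 1 := (Nat.ceil_lt_add_one (by positivity)).le
  have hprob := mul_exp_le_of_le_log he0 he1 hκ hκ1 hq hq1 hT hε hJ2 hN
  set β := 2 * (J : ℝ) * Real.exp (-(N * ε ^ 2 / 2)) with hβ
  have hβ0 : 0 ≤ β := by positivity
  set m : Ω → ℕ → Measure ℝ := fun ω k => predictEst ρ σ c η₁ (fun j n => clamp (U j n ω)) k with hm
  set bad : ℕ → Set Ω := fun k => Nat.casesOn k {ω | ∃ a, ε < |cdf (m ω 0) a - cdf η₁ a|}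
    fun j => {ω | ∃ a, ε < |cdf (m ω (j + 1)) a - cdf (predictStep ρ σ c (m ω j)) a|} with hbad
  have hbadP : ∀ k, P (bad k) ≤ ENNReal.ofReal β := by
    rintro (_ | k)
    · exact hU.measure_initial_le hN0 η₁ ρ σ c hε0 hJ1
    · exact hU.measure_step_le hN0 η₁ ρ σ hc.le hε0 hJ1 k
  set good : Set Ω := {ω | ∀ k < T,
    kolmogorovDist (filterEst ρ σ c η₁ (fun j n => U j n ω) k) (filterDist ρ σ c η₁ k) ≤ κ ∧
    kolmogorovDist (predictEst ρ σ c η₁ (fun j n => U j n ω) k) (predictDist ρ σ c η₁ k) ≤ κ}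
    with hgood
  have hcover : ∀ ω, (∀ k n, U k n ω ∈ Set.Ioo (0 : ℝ) 1 ×ˢ Set.Ioo (0 : ℝ) 1) →
      ω ∈ good ∪ ⋃ k ∈ Finset.range T, bad k := by
    intro ω hω
    by_contra hcon
    simp only [Set.mem_union, Set.mem_iUnion, Finset.mem_range, exists_prop, not_or, not_exists,
      not_and] at hcon
    obtain ⟨hng, hnb⟩ := hcon
    refine hng fun k hk => ?_
    have hclamp : (fun j n => clamp (U j n ω)) = fun j n => U j n ω := by
      ext1 j
      ext1 n
      exact clamp_of_mem (hω j n)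
    have hmp : ∀ k, IsProbabilityMeasure (m ω k) := fun k => isProbabilityMeasure_empirical hN0 _
    have hbound := hprop (m ω) hmp ε T hεε₀
      (fun a => by
        by_contra! h
        exact hnb 0 (by omega) ⟨a, h⟩)
      (fun j hj a => by
        by_contra! h
        exact hnb (j + 1) hj ⟨a, h⟩) k hk
    rw [← predictDist_eq_iterate ρ σ hc.le η₁ k, ← filterDist_eq_bayesUpdate ρ σ hc.le η₁ k] at hbound
    have hpe : m ω k = predictEst ρ σ c η₁ (fun j n => U j n ω) k := by simp only [hm, hclamp]
    have hfe : bayesUpdate c (m ω k) = filterEst ρ σ c η₁ (fun j n => U j n ω) k := by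
      rw [hpe, predictEst, ← weighted_eq_bayesUpdate c hN0]
      rfl
    rw [hfe, hpe] at hbound
    exact ⟨kolmogorovDist_le fun a => (hbound a).2.trans hCε,
      kolmogorovDist_le fun a => (hbound a).1.trans hCε⟩
  -- Subadditivity on a cover of almost all of Ω avoids taking complements, so measurability of
  -- `good` is not needed.
  have hone : (1 : ℝ≥0∞) ≤ P good + ENNReal.ofReal q := by
    have h1 : P Set.univ ≤ P (good ∪ ⋃ k ∈ Finset.range T, bad k) := by
      refine measure_mono_ae ?_
      filter_upwards [hU.ae_mem] with ω hω _
      exact hcover ω hω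
    rw [measure_univ] at h1
    refine h1.trans ((measure_union_le _ _).trans (add_le_add le_rfl ?_))
    refine (measure_biUnion_finset_le _ _).trans ((Finset.sum_le_sum fun k _ => hbadP k).trans ?_)
    rw [Finset.sum_const, Finset.card_range, nsmul_eq_mul, ← ENNReal.ofReal_natCast T,
      ← ENNReal.ofReal_mul (by positivity)]
    exact ENNReal.ofReal_le_ofReal hprob
  rw [ENNReal.ofReal_sub _ hq.le, ENNReal.ofReal_one]
  exact tsub_le_iff_right.2 hone
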